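/- **Games.** A game is played on a directed graph whose vertices are divided between Player 0 and Player 1; the owner of the current vertex chooses the next edge. In a request-response game with pairs $(P_j,R_j)_{1\le j\le K}$, a play $\varrho$ is won by Player 0 iff for all $j,i$ with $\varrho(i)\in P_j$ there is $i'\ge i$ with $\varrho(i')\in R_j$. In a Büchi game with set $F$ of final vertices, a play is won by Player 0 iff it visits $F$ infinitely often. **The games $\Gamma_k$.** Let $k\ge 1$. The graph $G_k=(V,E)$ has the vertices $a_i,p_i,p'_i,w_i,r_i,r'_i$ $(1\le i\le k)$, $x$, $y$; put $v:=a_1$ and $w:=w_1$. The edges are $a_i\to p_i$, $a_i\to p'_i$; $p_i,p'_i\to a_{i+1}$ for $i<k$; $p_k,p'_k\to w_1$; $w_i\to r_i$, $w_i\to r'_i$; $r_i,r'_i\to w_{i+1}$ for $i<k$; $r_k,r'_k\to x$; $x\to y$; $y\to y$. Player 0 owns the vertices $w_i$, Player 1 all others. The $K=2k+1$ request-response pairs are, in this order, $(P_0,R_0),(P_1,R_1),(P'_1,R'_1),\dots,(P_k,R_k),(P'_k,R'_k)$ with $P_0=\{v\}$, $R_0=\{w,y\}$, $P_i=\{p_i\}$,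 $P'_i=\{p'_i\}$, $R_i=\{r_i,y\}$, $R'_i=\{r'_i,y\}$. **The Büchi game $\Gamma'_k$.** Renumber the pairs as $1,\dots,K$. The vertex set is $S\times V$ with $S=2^{\{1,\dots,K\}}\times\{1,\dots,K\}\times\{0,1\}$; there is an edge from $(P,i,b,u)$ to $(P',i',b',u')$ iff $(u,u')\in E$, $P'=(P\cup\{j: u\in P_j\})\setminus\{j: u\in R_j\}$, $i'=i$ if $i\in P'$ and $i'=(i \bmod K)+1$ otherwise, and $b'=1$ iff $i=K$ and $i'=1$. The owner of a vertex is that of its $V$-component, and the final vertices are those with flag $b=1$. A positional strategy of Player 0 in $\Gamma'_k$ is an *attractor strategy* if at every vertex of Player 0 that lies outside the set $\mathrm{Recur}_0$ of the final vertices from which Player 0 can force infinitely many visits to final vertices, but in the attractor of this set, it decreases the attractor distance to this set, and if from vertices in $\mathrm{Recur}_0$ it stays in the attractor. Together with the memory update of $\Gamma'_k$, started in $(\emptyset,1,0)$, a positional strategy $f'$ in $\Gamma'_k$ is a Mealy automaton with state set $S$, which defines a strategy $f$ in $\Gamma_k$. **The reduced game.** The game automaton $\mathcal A$ of $\Gamma'_k$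 reads sequences of vertices of $G_k$. Its states are the elements of $S\times V$, an initial state $q_0$ and a rejecting sink. It moves from $q_0$ to $(\emptyset,1,0,u')$ when reading $u'$, from $(s,u)$ along the edge of $\Gamma'_k$ with target in $S\times\{u'\}$ when reading $u'$ with $(u,u')\in E$, and otherwise into the sink. Let $\mathcal A^-$ be $\mathcal A$ without the sink (which is never entered on plays of $G_k$). The closure of $\mathcal A^-$ has as final states the least set that contains the final states and every state all of whose successors it contains. For an equivalence relation $\approx$ on $S\times V$ let $s_1\approx_S s_2$ iff $(s_1,u)\approx(s_2,u)$ for all $u\in V$. The reduced game $\Gamma''_k$, with graph $G''_k$ on $(S/{\approx_S})\times V$, is the game of the quotient of $\mathcal A$ by $\approx_S$: for $(u,u')\in E$ the $u'$-successor of $([s],u)$ is $([s_{\min}],u')$, where $s_{\min}$ is the least memory content, for a fixed total order of $S$, that is reached from some $(\hat s,u)$ with $\hat s\approx_S s$ when reading $u'$. Here $\approx$ is direct bisimilarity in the closure of $\mathcal A^-$ (final states are visited at the same times), or mutual delayed simulation in $\mathcal A^-$ (each visit to a final state in one run is answered by a visit at the same time or later in the other). **Theorem.** For every $k\ge1$,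 $\Gamma_k$ is simulated by $\Gamma'_k$ with initial memory content $(\emptyset,1,0)$ (plays lift uniquely, and the winner is the same), and Player 0 wins $\Gamma_k$ from $v$. Moreover: 1. Attractor strategies in $\Gamma'_k$ exist. Every attractor strategy $f'_k$ is winning for Player 0 from $(\emptyset,1,0,v)$ in $\Gamma'_k$, and the strategy $f_k$ defined by it is winning for Player 0 from $v$ in $\Gamma_k$. Every Mealy automaton whose outputs agree with $f_k$ on the plays from $v$ that are played according to $f_k$ has at least $2^k$ states. 2. Every infinite path in $\Gamma'_k$, from any vertex, visits $(\emptyset,1,1,y)$ infinitely often; all states of $\mathcal A^-$ are final in its closure; and for each of the two choices of $\approx$ and each total order of $S$, the reduced game graph $G''_k$ has exactly one memory content, i.e. $|S/{\approx_S}|=1$. -/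

import Mathlib

open Filter

/-! ### Games on graphs -/

/-- A game arena: a directed graph whose vertices are partitioned into the set `V₀` of the
vertices of Player 0 and its complement, the vertices of Player 1. -/
structure Arena (V : Type) where
  V₀ : Set V
  E : V → V → Prop

/-- An infinite game: an arena with the set of the plays won by Player 0. -/
structure Game (V : Type) extends Arena V where
  win : Set (ℕ → V)

/-- Infinite paths (plays). -/
def Arena.IsPath {V : Type} (G : Arena V) (ρ : ℕ → V) : Prop :=
  ∀ n, G.E (ρ n) (ρ (n + 1))

/-- A strategy gets the past of the play (in chronological order) and the current vertex; only its
values at vertices of Player 0 matter. -/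
abbrev Strategy (V : Type) := List V → V → V

/-- The past `ρ(0) ⋯ ρ(n-1)` of a play at time `n`. -/
def past {V : Type} (ρ : ℕ → V) (n : ℕ) : List V := (List.range n).map ρ

/-- At every play prefix that ends in a vertex of Player 0, the strategy chooses an edge. -/
def Arena.IsStrategy {V : Type} (G : Arena V) (f : Strategy V) : Prop :=
  ∀ (h : List V) (v : V), v ∈ G.V₀ → (h ++ [v]).IsChain G.E → G.E v (f h v)

/-- The play `ρ` is played according to the strategy `f` of Player 0. -/
def Arena.Conforms {V : Type} (G : Arena V) (f : Strategy V) (ρ : ℕ → V) : Prop :=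
  ∀ n, ρ n ∈ G.V₀ → ρ (n + 1) = f (past ρ n) (ρ n)

def Game.IsWinningFrom {V : Type} (Γ : Game V) (f : Strategy V) (v : V) : Prop :=
  Γ.IsStrategy f ∧ ∀ ρ, Γ.IsPath ρ → ρ 0 = v → Γ.Conforms f ρ → ρ ∈ Γ.win

/-- Player 0 wins the game from `v`. -/
def Game.Wins {V : Type} (Γ : Game V) (v : V) : Prop :=
  ∃ f, Γ.IsWinningFrom f v

/-- The strategy given by a positional strategy. -/
def positional {V : Type} (g : V → V) : Strategy V := fun _ v => g v

/-- Mealy automata with set `M` of states (memory contents) that read the vertices of a play and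
output the next moves. -/
structure Mealy (V M : Type*) where
  init : M
  step : M → V → M
  out : M → V → V

/-- The strategy defined by a Mealy automaton. -/
def Mealy.toStrategy {V M : Type*} (C : Mealy V M) : List V → V → V :=
  fun h v => C.out (h.foldl C.step C.init) v

/-- The Mealy automaton `C` implements the strategy `f` for Player 0 from `v`: on the plays from `v`
that are played according to `f`, it outputs the moves of `f`. -/
def Mealy.Implements {V : Type} {M : Type*} (C : Mealy V M) (G : Arena V) (f : Strategy V) (v : V) :
    Prop :=
  ∀ ρ, G.IsPath ρ → ρ 0 = v → G.Conforms f ρ →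
    ∀ n, ρ n ∈ G.V₀ → C.toStrategy (past ρ n) (ρ n) = f (past ρ n) (ρ n)

/-- The game `Γ` is simulated by the game `Γ'` over the vertex set `S × V`, with initial memory
content `s₀`. -/
structure Simulates {V S : Type} (Γ : Game V) (s₀ : S) (Γ' : Game (S × V)) : Prop where
  owner : ∀ s v, (s, v) ∈ Γ'.V₀ ↔ v ∈ Γ.V₀
  exists_update : ∀ s v v', Γ.E v v' → ∃ s', Γ'.E (s, v) (s', v')
  unique_update : ∀ s v s₁ v₁ s₂ v₂,
    Γ'.E (s, v) (s₁, v₁) → Γ'.E (s, v) (s₂, v₂) → s₁ = s₂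
  edge : ∀ s v s' v', Γ'.E (s, v) (s', v') → Γ.E v v'
  win_iff : ∀ ρ : ℕ → V, ∀ ρ' : ℕ → S × V, Γ.IsPath ρ → Γ'.IsPath ρ' →
    ρ' 0 = (s₀, ρ 0) → (∀ n, (ρ' n).2 = ρ n) → (ρ ∈ Γ.win ↔ ρ' ∈ Γ'.win)

/-! ### Büchi games and attractor strategies -/

structure BuchiGame (V : Type) extends Arena V where
  F : Set V

def BuchiGame.toGame {V : Type} (Γ : BuchiGame V) : Game V where
  toArena := Γ.toArena
  win := {ρ | ∃ᶠ n in atTop, ρ n ∈ Γ.F}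

/-- The final vertices from which Player 0 can force infinitely many visits to `F`. -/
def BuchiGame.recur {V : Type} (Γ : BuchiGame V) : Set V :=
  {v | v ∈ Γ.F ∧ Γ.toGame.Wins v}

/-- The vertices from which Player 0 can force a visit to `T` within `n` moves. -/
def Arena.attr {V : Type} (G : Arena V) (T : Set V) : ℕ → Set V
  | 0 => T
  | n + 1 => G.attr T n ∪ {v | v ∈ G.V₀ ∧ ∃ u, G.E v u ∧ u ∈ G.attr T n} ∪
      {v | v ∉ G.V₀ ∧ ∀ u, G.E v u → u ∈ G.attr T n}

/-- Positional attractor strategies of a Büchi game: at a vertex of the attractor of `recur`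
outside `recur`, the distance to `recur` is decreased; from a vertex of `recur`, the play stays in
the attractor. -/
structure BuchiGame.IsAttractorStrategy {V : Type} (Γ : BuchiGame V) (g : V → V) : Prop where
  edge : ∀ v ∈ Γ.V₀, Γ.E v (g v)
  decrease : ∀ v ∈ Γ.V₀, ∀ n, v ∈ Γ.attr Γ.recur (n + 1) → v ∉ Γ.attr Γ.recur n →
    g v ∈ Γ.attr Γ.recur n
  stay : ∀ v ∈ Γ.V₀, v ∈ Γ.recur → ∃ n, g v ∈ Γ.attr Γ.recur n

/-! ### Request-response games and their simulation by Büchi games -/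

/-- A request-response game with `K` pairs `(P j, R j)`. -/
structure RRGame (V : Type) (K : ℕ) extends Arena V where
  P : Fin K → Set V
  R : Fin K → Set V

def RRGame.toGame {V : Type} {K : ℕ} (Γ : RRGame V K) : Game V where
  toArena := Γ.toArena
  win := {ρ | ∀ j, ∀ i, ρ i ∈ Γ.P j → ∃ i', i ≤ i' ∧ ρ i' ∈ Γ.R j}

/-- The memory contents of the simulating Büchi game: the set of the open requests, the marker and
the flag. The pairs are numbered from `0` to `K - 1` here, so that the marker values
`1, …, K` become `0, …, K - 1`. -/
abbrev RRMemory (K : ℕ) := Set (Fin K) × Fin K × Bool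

/-- The initial memory content `(∅, 1, 0)`. -/
def RRMemory.start (K : ℕ) [NeZero K] : RRMemory K := (∅, 0, false)

namespace RRGame

variable {V : Type} {K : ℕ}

/-- The set of open requests after leaving `v`. -/
def openRequests (Γ : RRGame V K) (s : RRMemory K) (v : V) : Set (Fin K) :=
  (s.1 ∪ {j | v ∈ Γ.P j}) \ {j | v ∈ Γ.R j}

open Classical in
/-- The marker after leaving `v`; the addition in `Fin K` is cyclic. -/
noncomputable def marker [NeZero K] (Γ : RRGame V K) (s : RRMemory K) (v : V) : Fin K :=
  if s.2.1 ∈ Γ.openRequests s v then s.2.1 else s.2.1 + 1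

open Classical in
/-- The memory content after leaving `v`; the flag is set when the marker passes from the last
value to the first one. -/
noncomputable def update [NeZero K] (Γ : RRGame V K) (s : RRMemory K) (v : V) : RRMemory K :=
  (Γ.openRequests s v, Γ.marker s v,
    decide ((s.2.1 : ℕ) + 1 = K ∧ Γ.marker s v = 0))

/-- The Büchi game that simulates a request-response game. -/
def buchi [NeZero K] (Γ : RRGame V K) : BuchiGame (RRMemory K × V) where
  V₀ := {p | p.2 ∈ Γ.V₀}
  E := fun p p' => p'.1 = Γ.update p.1 p.2 ∧ Γ.E p.2 p'.2
  F := {p | p.1.2.2 = true}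

/-- The strategy automaton for the request-response game with memory `RRMemory K` obtained from a
positional strategy in the simulating Büchi game. -/
noncomputable def strategyAutomaton [NeZero K] (Γ : RRGame V K)
    (g : RRMemory K × V → RRMemory K × V) : Mealy V (RRMemory K) where
  init := RRMemory.start K
  step := fun s v => Γ.update s v
  out := fun s v => (g (s, v)).2

end RRGame

/-! ### Automata, delayed simulation, direct bisimulation and the closure -/

/-- An automaton on infinite words over `A`, with an abstract acceptance condition on runs. -/
structure OmegaAutomaton (Q A : Type) where
  init : Q
  Δ : Q → A → Q → Prop
  acc : Set (ℕ → Q)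

structure BuchiAutomaton (Q A : Type) where
  init : Q
  Δ : Q → A → Q → Prop
  F : Set Q

/-- Simulation and bisimulation games on two copies of a transition relation `Δ`. A move of Spoiler
consists of the run that he extends (`false`: the first one, `true`: the second one), the letter and
the new state; Duplicator answers in the other run with the same letter. Histories list the moves of
Spoiler, the last one first, and a strategy `d` of Duplicator maps each nonempty history to the new
state of the run that she extends. -/
abbrev SpoilerMove (Q A : Type) := Bool × A × Q

section SimulationGame

variable {Q A : Type}

/-- The pair of current states after a history. -/
def positions (d : List (SpoilerMove Q A) → Q) (q q' : Q) : List (SpoilerMove Q A) → Q × Q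
  | [] => (q, q')
  | (false, a, p) :: h => (p, d ((false, a, p) :: h))
  | (true, a, p) :: h => (d ((true, a, p) :: h), p)

/-- The component of a pair that belongs to the given run. -/
def side (b : Bool) (p : Q × Q) : Q := if b then p.2 else p.1

/-- All moves of Spoiler in the history are legal; `sides` is the set of the runs that Spoiler is
allowed to extend. -/
def IsHistory (Δ : Q → A → Q → Prop) (sides : Set Bool) (d : List (SpoilerMove Q A) → Q)
    (q q' : Q) : List (SpoilerMove Q A) → Prop
  | [] => True
  | m :: h => IsHistory Δ sides d q q' h ∧ m.1 ∈ sides ∧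
      Δ (side m.1 (positions d q q' h)) m.2.1 m.2.2

/-- The history formed by the first `n` moves of a sequence. -/
def histOf (μ : ℕ → SpoilerMove Q A) : ℕ → List (SpoilerMove Q A)
  | 0 => []
  | n + 1 => μ n :: histOf μ n

/-- Duplicator has a winning strategy from `(q, q')`: she can answer every legal move, and the two
runs of every infinite play satisfy `W`. -/
def DuplicatorWins (Δ : Q → A → Q → Prop) (sides : Set Bool)
    (W : (ℕ → Q) → (ℕ → Q) → Prop) (q q' : Q) : Prop :=
  ∃ d : List (SpoilerMove Q A) → Q,
    (∀ m h, IsHistory Δ sides d q q' (m :: h) →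
      Δ (side (!m.1) (positions d q q' h)) m.2.1 (d (m :: h))) ∧
    ∀ μ : ℕ → SpoilerMove Q A, (∀ n, IsHistory Δ sides d q q' (histOf μ n)) →
      W (fun n => (positions d q q' (histOf μ n)).1) (fun n => (positions d q q' (histOf μ n)).2)

end SimulationGame

namespace BuchiAutomaton

variable {Q A : Type}

def toOmega (B : BuchiAutomaton Q A) : OmegaAutomaton Q A where
  init := B.init
  Δ := B.Δ
  acc := {ρ | ∃ᶠ n in atTop, ρ n ∈ B.F}

/-- `q'` delayed simulates `q`. -/
def DelayedSim (B : BuchiAutomaton Q A) (q q' : Q) : Prop :=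
  DuplicatorWins B.Δ {false} (fun ρ ρ' => ∀ i, ρ i ∈ B.F → ∃ j, i ≤ j ∧ ρ' j ∈ B.F) q q'

/-- `q` and `q'` delayed simulate each other. -/
def DelayedEquiv (B : BuchiAutomaton Q A) (q q' : Q) : Prop :=
  B.DelayedSim q q' ∧ B.DelayedSim q' q

/-- `q` and `q'` are direct bisimilar. -/
def DirectBisim (B : BuchiAutomaton Q A) (q q' : Q) : Prop :=
  DuplicatorWins B.Δ Set.univ (fun ρ ρ' => ∀ i, ρ i ∈ B.F ↔ ρ' i ∈ B.F) q q'

/-- The final states of the closure: the least set that contains `F` and every state all of whose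
successors it contains. -/
inductive InClosure (B : BuchiAutomaton Q A) : Q → Prop
  | base (q : Q) : q ∈ B.F → InClosure B q
  | step (q : Q) : (∀ a q', B.Δ q a q' → InClosure B q') → InClosure B q

def closure (B : BuchiAutomaton Q A) : BuchiAutomaton Q A where
  init := B.init
  Δ := B.Δ
  F := {q | B.InClosure q}

end BuchiAutomaton

/-! The relations above are equivalence relations: strategies of Duplicator can be copied, mirrored
and composed. -/

section Equivalences

variable {Q A : Type}

theorem DuplicatorWins.refl (Δ : Q → A → Q → Prop) (sides : Set Bool)
    {W : (ℕ → Q) → (ℕ → Q) → Prop} (hW : ∀ ρ, W ρ ρ) (q : Q) :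
    DuplicatorWins Δ sides W q q := by
  let d : List (SpoilerMove Q A) → Q := fun h => match h with
    | [] => q
    | m :: _ => m.2.2
  have key : ∀ h, (positions d q q h).2 = (positions d q q h).1 := by
    rintro (_ | ⟨⟨b, a, p⟩, h⟩)
    · rfl
    · cases b <;> rfl
  refine ⟨d, ?_, ?_⟩
  · rintro ⟨b, a, p⟩ h ⟨-, -, h3⟩
    have := key h
    cases b <;> simp_all [side, d]
  · intro μ _
    simp only [key]
    exact hW _

def SpoilerMove.swap (m : SpoilerMove Q A) : SpoilerMove Q A := (!m.1, m.2)

theorem DuplicatorWins.symm {Δ : Q → A → Q → Prop} {W : (ℕ → Q) → (ℕ → Q) → Prop}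
    (hW : ∀ ρ ρ', W ρ ρ' → W ρ' ρ) {q q' : Q} (H : DuplicatorWins Δ Set.univ W q q') :
    DuplicatorWins Δ Set.univ W q' q := by
  obtain ⟨d, h1, h2⟩ := H
  let d' : List (SpoilerMove Q A) → Q := fun h => d (h.map SpoilerMove.swap)
  have key : ∀ h, positions d' q' q h = (positions d q q' (h.map SpoilerMove.swap)).swap := by
    rintro (_ | ⟨⟨b, a, p⟩, h⟩)
    · rfl
    · cases b <;> rfl
  have key2 : ∀ h, IsHistory Δ Set.univ d' q' q h →
      IsHistory Δ Set.univ d q q' (h.map SpoilerMove.swap) := by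
    intro h
    induction h with
    | nil => exact id
    | cons m h ih =>
      rintro ⟨a1, -, a3⟩
      refine ⟨ih a1, trivial, ?_⟩
      rw [key] at a3
      obtain ⟨b, a, p⟩ := m
      cases b <;> simpa [SpoilerMove.swap, side] using a3
  refine ⟨d', ?_, ?_⟩
  · intro m h hm
    have := h1 _ _ (key2 _ hm)
    rw [key]
    obtain ⟨b, a, p⟩ := m
    cases b <;> simpa [SpoilerMove.swap, side, d'] using this
  · intro μ hμ
    have e : ∀ n, (histOf μ n).map SpoilerMove.swap = histOf (fun n => (μ n).swap) n := by
      intro n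
      induction n with
      | zero => rfl
      | succ n ih => simp [histOf, ih]
    have := h2 (fun n => (μ n).swap) (fun n => by rw [← e]; exact key2 _ (hμ n))
    simp only [key, e]
    exact hW _ _ this

/-- The histories of the two games that are played when two strategies are composed. -/
def composeHist (d₁ d₂ : List (SpoilerMove Q A) → Q) :
    List (SpoilerMove Q A) → List (SpoilerMove Q A) × List (SpoilerMove Q A)
  | [] => ([], [])
  | (false, a, p) :: h =>
    ((false, a, p) :: (composeHist d₁ d₂ h).1,
      (false, a, d₁ ((false, a, p) :: (composeHist d₁ d₂ h).1)) :: (composeHist d₁ d₂ h).2)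
  | (true, a, p) :: h =>
    ((true, a, d₂ ((true, a, p) :: (composeHist d₁ d₂ h).2)) :: (composeHist d₁ d₂ h).1,
      (true, a, p) :: (composeHist d₁ d₂ h).2)

theorem DuplicatorWins.trans {Δ : Q → A → Q → Prop} {sides : Set Bool}
    {W : (ℕ → Q) → (ℕ → Q) → Prop} (hW : ∀ ρ ρ' ρ'', W ρ ρ' → W ρ' ρ'' → W ρ ρ'')
    {q q' q'' : Q} (H₁ : DuplicatorWins Δ sides W q q') (H₂ : DuplicatorWins Δ sides W q' q'') :
    DuplicatorWins Δ sides W q q'' := by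
  obtain ⟨d₁, l₁, w₁⟩ := H₁
  obtain ⟨d₂, l₂, w₂⟩ := H₂
  let d : List (SpoilerMove Q A) → Q := fun h => match h with
    | [] => q
    | (false, a, p) :: t => d₂ (composeHist d₁ d₂ ((false, a, p) :: t)).2
    | (true, a, p) :: t => d₁ (composeHist d₁ d₂ ((true, a, p) :: t)).1
  have mid : ∀ h, (positions d₂ q' q'' (composeHist d₁ d₂ h).2).1 =
      (positions d₁ q q' (composeHist d₁ d₂ h).1).2 := by
    rintro (_ | ⟨⟨b, a, p⟩, h⟩)
    · rfl
    · cases b <;> rfl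
  have fst : ∀ h, (positions d q q'' h).1 = (positions d₁ q q' (composeHist d₁ d₂ h).1).1 := by
    rintro (_ | ⟨⟨b, a, p⟩, h⟩)
    · rfl
    · cases b <;> rfl
  have snd : ∀ h, (positions d q q'' h).2 = (positions d₂ q' q'' (composeHist d₁ d₂ h).2).2 := by
    rintro (_ | ⟨⟨b, a, p⟩, h⟩)
    · rfl
    · cases b <;> rfl
  have legal : ∀ h, IsHistory Δ sides d q q'' h →
      IsHistory Δ sides d₁ q q' (composeHist d₁ d₂ h).1 ∧
      IsHistory Δ sides d₂ q' q'' (composeHist d₁ d₂ h).2 := by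
    intro h
    induction h with
    | nil => exact fun _ => ⟨trivial, trivial⟩
    | cons m h ih =>
      rintro ⟨a1, a2, a3⟩
      obtain ⟨i1, i2⟩ := ih a1
      obtain ⟨b, a, p⟩ := m
      cases b
      · have k1 : IsHistory Δ sides d₁ q q' ((false, a, p) :: (composeHist d₁ d₂ h).1) :=
          ⟨i1, a2, by simpa [side, fst] using a3⟩
        refine ⟨k1, i2, a2, ?_⟩
        have := l₁ _ _ k1
        simpa [side, mid] using this
      · have k2 : IsHistory Δ sides d₂ q' q'' ((true, a, p) :: (composeHist d₁ d₂ h).2) :=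
          ⟨i2, a2, by simpa [side, snd] using a3⟩
        refine ⟨⟨i1, a2, ?_⟩, k2⟩
        have := l₂ _ _ k2
        simpa [side, mid] using this
  refine ⟨d, ?_, ?_⟩
  · intro m h hm
    obtain ⟨k1, k2⟩ := legal _ hm
    obtain ⟨b, a, p⟩ := m
    cases b
    · have := l₂ _ _ k2
      change Δ (positions d q q'' h).2 a _
      rw [snd]
      exact this
    · have := l₁ _ _ k1
      change Δ (positions d q q'' h).1 a _
      rw [fst]
      exact this
  · intro μ hμ
    have ex : ∃ μ₁ μ₂ : ℕ → SpoilerMove Q A, ∀ n,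
        composeHist d₁ d₂ (histOf μ n) = (histOf μ₁ n, histOf μ₂ n) := by
      refine ⟨fun n => ((composeHist d₁ d₂ (histOf μ (n + 1))).1).headD (μ n),
        fun n => ((composeHist d₁ d₂ (histOf μ (n + 1))).2).headD (μ n), ?_⟩
      intro n
      induction n with
      | zero => rfl
      | succ n ih =>
        simp only [histOf] at ih ⊢
        rcases μ n with ⟨b, a, p⟩
        cases b <;> simp [composeHist, ih]
    obtain ⟨μ₁, μ₂, e⟩ := ex
    have r₁ := w₁ μ₁ (fun n => by have := (legal _ (hμ n)).1; rwa [e] at this)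
    have r₂ := w₂ μ₂ (fun n => by have := (legal _ (hμ n)).2; rwa [e] at this)
    have mid' : ∀ n, (positions d₂ q' q'' (histOf μ₂ n)).1 =
        (positions d₁ q q' (histOf μ₁ n)).2 := fun n => by
      have := mid (histOf μ n); rwa [e] at this
    simp only [mid'] at r₂
    simp only [fst, snd, e]
    exact hW _ _ _ r₁ r₂

namespace BuchiAutomaton

theorem delayedSim_refl (B : BuchiAutomaton Q A) (q : Q) : B.DelayedSim q q :=
  DuplicatorWins.refl _ _ (fun _ i hi => ⟨i, le_rfl, hi⟩) q

theorem delayedSim_trans (B : BuchiAutomaton Q A) {q q' q'' : Q} (h : B.DelayedSim q q')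
    (h' : B.DelayedSim q' q'') : B.DelayedSim q q'' := by
  refine DuplicatorWins.trans ?_ h h'
  intro ρ ρ' ρ'' h1 h2 i hi
  obtain ⟨j, hj, hj'⟩ := h1 i hi
  obtain ⟨l, hl, hl'⟩ := h2 j hj'
  exact ⟨l, hj.trans hl, hl'⟩

/-- The equivalence relation of mutual delayed simulation. -/
def delayedSetoid (B : BuchiAutomaton Q A) : Setoid Q where
  r := B.DelayedEquiv
  iseqv :=
    { refl := fun q => ⟨B.delayedSim_refl q, B.delayedSim_refl q⟩
      symm := fun h => ⟨h.2, h.1⟩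
      trans := fun h h' => ⟨B.delayedSim_trans h.1 h'.1, B.delayedSim_trans h'.2 h.2⟩ }

/-- The equivalence relation of direct bisimilarity. -/
def directSetoid (B : BuchiAutomaton Q A) : Setoid Q where
  r := B.DirectBisim
  iseqv :=
    { refl := fun q => DuplicatorWins.refl _ _ (fun _ _ => Iff.rfl) q
      symm := fun h => DuplicatorWins.symm (fun _ _ h i => (h i).symm) h
      trans := fun h h' =>
        DuplicatorWins.trans (fun _ _ _ h h' i => (h i).trans (h' i)) h h' }

/-- The restriction of an automaton to a set of states that contains the initial state. -/
def restrict (B : BuchiAutomaton Q A) (X : Set Q) (hX : B.init ∈ X) : BuchiAutomaton X A where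
  init := ⟨B.init, hX⟩
  Δ := fun q a q' => B.Δ q a q'
  F := {q | (q : Q) ∈ B.F}

end BuchiAutomaton

end Equivalences

/-! ### Game automata, their quotients and the memory reduction -/

/-- The states of a game automaton: a fresh initial state, the pairs of a memory content and a
vertex, and a sink. -/
inductive GAState (S V : Type)
  | init : GAState S V
  | mem (s : S) (v : V) : GAState S V
  | sink : GAState S V

/-- The vertex component of a state. -/
def GAState.vertex? {S V : Type} : GAState S V → Option V
  | .init => none
  | .mem _ v => some v
  | .sink => none

section Reduction

variable {S V : Type}

/-- The transitions of the game automaton of a game over `S × V` that simulates a game on the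
arena `G`. -/
inductive gaStep (G : Arena V) (s₀ : S) (G' : Arena (S × V)) :
    GAState S V → V → GAState S V → Prop
  | init (v' : V) : gaStep G s₀ G' .init v' (.mem s₀ v')
  | edge (s : S) (v : V) (s' : S) (v' : V) :
      G'.E (s, v) (s', v') → gaStep G s₀ G' (.mem s v) v' (.mem s' v')
  | noEdge (s : S) (v v' : V) : ¬ G.E v v' → gaStep G s₀ G' (.mem s v) v' .sink
  | sink (v' : V) : gaStep G s₀ G' .sink v' .sink

/-- The game automaton of a simulating Büchi game. -/
def gameAutomaton (G : Arena V) (s₀ : S) (Γ' : BuchiGame (S × V)) :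
    BuchiAutomaton (GAState S V) V where
  init := .init
  Δ := gaStep G s₀ Γ'.toArena
  F := {q | ∃ s v, q = .mem s v ∧ (s, v) ∈ Γ'.F}

/-- The states of a game automaton other than the sink. -/
abbrev LiveState (S V : Type) := {q : GAState S V | q ≠ .sink}

def LiveState.mem (s : S) (v : V) : LiveState S V := ⟨.mem s v, by simp⟩

/-- The game automaton without its sink. Its inputs are the plays of the game, and on them the sink
is never entered. The delayed simulation and the closure refer to this automaton. -/
def liveAutomaton (G : Arena V) (s₀ : S) (Γ' : BuchiGame (S × V)) :
    BuchiAutomaton (LiveState S V) V :=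
  (gameAutomaton G s₀ Γ').restrict {q | q ≠ .sink} (by simp [gameAutomaton])

/-- The restriction to `S × V` of an equivalence relation on the states. -/
def onPairs (r : Setoid (LiveState S V)) : Setoid (S × V) :=
  r.comap fun p => LiveState.mem p.1 p.2

/-- The equivalence relation on the memory contents derived from an equivalence relation on
`S × V`. -/
def memSetoid (r : Setoid (S × V)) : Setoid S where
  r := fun s₁ s₂ => ∀ v, r (s₁, v) (s₂, v)
  iseqv :=
    { refl := fun _ _ => r.refl _
      symm := fun h v => r.symm (h v)
      trans := fun h h' v => r.trans (h v) (h' v) }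

/-- `s` is the least element of `X` with respect to the strict order `prec`. -/
def IsLeastFor (prec : S → S → Prop) (X : Set S) (s : S) : Prop :=
  s ∈ X ∧ ∀ t ∈ X, s = t ∨ prec s t

/-- The transitions of the quotient automaton; the target is determined by the least memory content
that is reached from some element of the class. -/
inductive quotientStep (G : Arena V) (Δ : GAState S V → V → GAState S V → Prop) (e : Setoid S)
    (prec : S → S → Prop) : GAState (Quotient e) V → V → GAState (Quotient e) V → Prop
  | init (v' : V) (s' : S) : IsLeastFor prec {t | Δ .init v' (.mem t v')} s' →
      quotientStep G Δ e prec .init v' (.mem (Quotient.mk e s') v')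
  | edge (c : Quotient e) (v v' : V) (s' : S) : G.E v v' →
      IsLeastFor prec {t | ∃ s, Quotient.mk e s = c ∧ Δ (.mem s v) v' (.mem t v')} s' →
      quotientStep G Δ e prec (.mem c v) v' (.mem (Quotient.mk e s') v')
  | noEdge (c : Quotient e) (v v' : V) : ¬ G.E v v' →
      quotientStep G Δ e prec (.mem c v) v' .sink
  | sink (v' : V) : quotientStep G Δ e prec .sink v' .sink

/-- The quotient of a game automaton by an equivalence relation on the memory contents. A run is
accepting if the run of the given automaton through the same vertices is. -/
def quotientAutomaton (G : Arena V) (B : BuchiAutomaton (GAState S V) V) (e : Setoid S)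
    (prec : S → S → Prop) : OmegaAutomaton (GAState (Quotient e) V) V where
  init := .init
  Δ := quotientStep G B.Δ e prec
  acc := {ρ | ∃ ρ' : ℕ → GAState S V, ρ' 0 = .init ∧ (∀ n, ∃ a, B.Δ (ρ' n) a (ρ' (n + 1))) ∧
    (∀ n, (ρ' n).vertex? = (ρ n).vertex?) ∧ ρ' ∈ B.toOmega.acc}

/-- A game whose vertices are pairs of a memory content and a vertex. -/
structure MemoryGame (V : Type) where
  Mem : Type
  start : Mem
  game : Game (Mem × V)

/-- The automaton game: the game graph consists of the pairs of a memory content and a vertex, and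
a play is won by Player 0 if, preceded by the initial state, it is an accepting run. -/
def automatonGame (G : Arena V) (start : S) (B : OmegaAutomaton (GAState S V) V) :
    MemoryGame V where
  Mem := S
  start := start
  game :=
    { V₀ := {p | p.2 ∈ G.V₀}
      E := fun p p' => B.Δ (.mem p.1 p.2) p'.2 (.mem p'.1 p'.2)
      win := {ρ | (fun n => match n with
        | 0 => GAState.init
        | n + 1 => GAState.mem (ρ n).1 (ρ n).2) ∈ B.acc} }

end Reduction

namespace RRGame

variable {V : Type} {K : ℕ} [NeZero K]

/-- The game automaton (without its sink) of the Büchi game that simulates `Γ`. -/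
noncomputable def automaton (Γ : RRGame V K) : BuchiAutomaton (LiveState (RRMemory K) V) V :=
  liveAutomaton Γ.toArena (RRMemory.start K) Γ.buchi

/-- The result of the memory reduction for a given equivalence relation on the pairs of a memory
content and a vertex: the automaton game of the quotient of the game automaton. -/
noncomputable def reducedGame (Γ : RRGame V K) (r : Setoid (RRMemory K × V))
    (prec : RRMemory K → RRMemory K → Prop) : MemoryGame V :=
  automatonGame Γ.toArena (Quotient.mk (memSetoid r) (RRMemory.start K))
    (quotientAutomaton Γ.toArena (gameAutomaton Γ.toArena (RRMemory.start K) Γ.buchi)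
      (memSetoid r) prec)

/-- The memory reduction algorithm: the equivalence relation is the direct bisimilarity in the
closure of the game automaton. -/
noncomputable def memoryReduction (Γ : RRGame V K) (prec : RRMemory K → RRMemory K → Prop) :
    MemoryGame V :=
  Γ.reducedGame (onPairs Γ.automaton.closure.directSetoid) prec

/-- The memory reduction with the equivalence relation of mutual delayed simulation in the game
automaton. -/
noncomputable def delayedReduction (Γ : RRGame V K) (prec : RRMemory K → RRMemory K → Prop) :
    MemoryGame V :=
  Γ.reducedGame (onPairs Γ.automaton.delayedSetoid) prec

end RRGame

/-! ### The game graphs `G_k` -/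

/-- The vertices of `G_k`, where indices are counted from `0` and `k` is positive: `a 0` is the
vertex `v`, and `w 0` is the vertex `w`. -/
inductive Vertex (k : ℕ)
  | a (i : Fin k) : Vertex k
  | p (i : Fin k) : Vertex k
  | p' (i : Fin k) : Vertex k
  | w (i : Fin k) : Vertex k
  | r (i : Fin k) : Vertex k
  | r' (i : Fin k) : Vertex k
  | x : Vertex k
  | y : Vertex k

/-- The edges of `G_k`. -/
inductive Edge {k : ℕ} : Vertex k → Vertex k → Prop
  | request (i : Fin k) : Edge (.a i) (.p i)
  | request' (i : Fin k) : Edge (.a i) (.p' i)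
  | next (i j : Fin k) : (j : ℕ) = i + 1 → Edge (.p i) (.a j)
  | next' (i j : Fin k) : (j : ℕ) = i + 1 → Edge (.p' i) (.a j)
  | switch (i j : Fin k) : (i : ℕ) + 1 = k → (j : ℕ) = 0 → Edge (.p i) (.w j)
  | switch' (i j : Fin k) : (i : ℕ) + 1 = k → (j : ℕ) = 0 → Edge (.p' i) (.w j)
  | response (i : Fin k) : Edge (.w i) (.r i)
  | response' (i : Fin k) : Edge (.w i) (.r' i)
  | onward (i j : Fin k) : (j : ℕ) = i + 1 → Edge (.r i) (.w j)
  | onward' (i j : Fin k) : (j : ℕ) = i + 1 → Edge (.r' i) (.w j)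
  | finish (i : Fin k) : (i : ℕ) + 1 = k → Edge (.r i) .x
  | finish' (i : Fin k) : (i : ℕ) + 1 = k → Edge (.r' i) .x
  | last : Edge .x .y
  | loop : Edge .y .y

/-- The request-response game `Γ_k`. The pairs are listed in the order
`(P_0, R_0), (P_1, R_1), (P'_1, R'_1), …, (P_k, R_k), (P'_k, R'_k)`. -/
def gammaGame (k : ℕ) : RRGame (Vertex k) (2 * k + 1) where
  V₀ := {u | ∃ i, u = .w i}
  E := Edge
  P := fun j => {u | (∃ i : Fin k, u = .a i ∧ (i : ℕ) = 0 ∧ (j : ℕ) = 0) ∨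
    (∃ i : Fin k, u = .p i ∧ (j : ℕ) = 2 * i + 1) ∨
    (∃ i : Fin k, u = .p' i ∧ (j : ℕ) = 2 * i + 2)}
  R := fun j => {u | u = .y ∨ (∃ i : Fin k, u = .w i ∧ (i : ℕ) = 0 ∧ (j : ℕ) = 0) ∨
    (∃ i : Fin k, u = .r i ∧ (j : ℕ) = 2 * i + 1) ∨
    (∃ i : Fin k, u = .r' i ∧ (j : ℕ) = 2 * i + 2)}

/-!
Every path of `G_k` runs into `y`, where all requests are closed, so that the marker advances with
every move and wraps around after the last pair. The distance to `y` together with the marker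
therefore yields a ranking function for the visits to `(∅, 1, 1, y)`. Hence Player 0 wins every play
of the Büchi game, all final vertices belong to `Recur_0`, all states are final in the closure, and
Duplicator wins the two simulation games from any two states with the same vertex by copying the
letters, so that all memory contents are equivalent.

An attractor strategy heads for the first final vertex. If the open one of the two requests with
index `i` is answered at `w_i`, then the marker advances with every move, as it never meets an open
request, and the flag is set at the move from `x` to `y`. The other answer leaves a request open
until `y`, so that the marker is blocked and the flag is set later. Thus an attractor strategy
repeats the `k` binary choices made by Player 1 on the way to `w_1`, and an automaton that
implements it has to be in different states at `w_1` after different choices.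
-/

/-! ### Ranking functions and attractors -/

/-- A ranking function for the target set `T`: it decreases along every step of `r` that does not
lead to `T`. It bounds the attractor distance to `T`, it shows that all infinite `r`-paths visit `T`
infinitely often, and it lets the closure of an automaton with final states `T` be computed. -/
def IsRankingFunction {V α : Type*} [LT α] (r : V → V → Prop) (T : Set V) (Φ : V → α) : Prop :=
  ∀ v u, r v u → Φ u < Φ v ∨ u ∈ T

namespace IsRankingFunction

theorem mono {V α : Type*} [LT α] {r : V → V → Prop} {T T' : Set V} {Φ : V → α}
    (hΦ : IsRankingFunction r T Φ) (h : T ⊆ T') : IsRankingFunction r T' Φ :=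
  fun v u hvu => (hΦ v u hvu).imp_right (@h u)

theorem frequently_mem {V α : Type*} [Preorder α] [WellFoundedLT α] {r : V → V → Prop} {T : Set V}
    {Φ : V → α} (hΦ : IsRankingFunction r T Φ) {ρ : ℕ → V} (hρ : ∀ n, r (ρ n) (ρ (n + 1))) :
    ∃ᶠ n in atTop, ρ n ∈ T := by
  rw [frequently_atTop]
  intro n
  by_contra! hT
  refine WellFounded.not_rel_apply_succ (r := ((· < ·) : α → α → Prop))
    (fun m => Φ (ρ (n + m))) |>.elim fun m hm => hm ?_
  exact (hΦ _ _ (hρ (n + m))).resolve_right (hT _ (by omega))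

end IsRankingFunction

namespace Arena

variable {V : Type} (G : Arena V) (T : Set V)

theorem attr_mono : Monotone (G.attr T) :=
  monotone_nat_of_le_succ fun _ _ hv => Or.inl (Or.inl hv)

variable {G T} in
theorem mem_attr_succ_of_forall (hG : Relator.LeftTotal G.E) {v : V} {n : ℕ}
    (h : ∀ u, G.E v u → u ∈ G.attr T n) : v ∈ G.attr T (n + 1) := by
  obtain ⟨u, hu⟩ := hG v
  by_cases hv : v ∈ G.V₀
  · exact Or.inl (Or.inr ⟨hv, u, hu, h u hu⟩)
  · exact Or.inr ⟨hv, h⟩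

/-- The vertices such that no path from them visits `T` at one of the times `0, …, n - 1`. -/
def avoiding : ℕ → Set V
  | 0 => Set.univ
  | n + 1 => {v | v ∉ T ∧ ∀ u, G.E v u → u ∈ avoiding n}

theorem avoiding_antitone : Antitone (G.avoiding T) := by
  refine antitone_nat_of_succ_le fun n => ?_
  induction n with
  | zero => exact Set.subset_univ _
  | succ n ih => exact fun v hv => ⟨hv.1, fun u hu => ih (hv.2 u hu)⟩

variable {G T}

theorem notMem_attr_of_mem_avoiding (hG : Relator.LeftTotal G.E) {n : ℕ} {v : V}
    (hv : v ∈ G.avoiding T (n + 1)) : v ∉ G.attr T n := by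
  induction n generalizing v with
  | zero => exact hv.1
  | succ n ih =>
    rintro ((h | ⟨-, u, hu, h⟩) | ⟨-, h⟩)
    · exact ih (G.avoiding_antitone T (Nat.le_succ _) hv) h
    · exact ih (hv.2 u hu) h
    · obtain ⟨u, hu⟩ := hG v
      exact ih (hv.2 u hu) (h u hu)

end Arena

theorem IsRankingFunction.mem_attr {V : Type} {G : Arena V} {T : Set V} {Φ : V → ℕ}
    (hΦ : IsRankingFunction G.E T Φ) (hG : Relator.LeftTotal G.E) (v : V) :
    v ∈ G.attr T (Φ v + 1) := by
  induction h : Φ v using Nat.strong_induction_on generalizing v with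
  | _ n ih =>
    refine Arena.mem_attr_succ_of_forall hG fun u hu => ?_
    rcases hΦ v u hu with hlt | hT
    · exact G.attr_mono T (by omega) (ih (Φ u) (h ▸ hlt) u rfl)
    · exact G.attr_mono T (Nat.zero_le n) hT

/-! ### Büchi games in which all plays are won by Player 0 -/

theorem Arena.isStrategy_positional {V : Type} {G : Arena V} {g : V → V}
    (hg : ∀ v ∈ G.V₀, G.E v (g v)) : G.IsStrategy (positional g) :=
  fun _ v hv _ => hg v hv

theorem Game.isWinningFrom_positional {V : Type} {Γ : Game V} (hwin : ∀ ρ, Γ.IsPath ρ → ρ ∈ Γ.win)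
    {g : V → V} (hg : ∀ v ∈ Γ.V₀, Γ.E v (g v)) (v : V) : Γ.IsWinningFrom (positional g) v :=
  ⟨Arena.isStrategy_positional hg, fun ρ hρ _ _ => hwin ρ hρ⟩

namespace BuchiGame

variable {V : Type} {Γ : BuchiGame V}

theorem recur_eq_of_forall_isPath (hΓ : Relator.LeftTotal Γ.E)
    (hwin : ∀ ρ, Γ.toGame.IsPath ρ → ρ ∈ Γ.toGame.win) : Γ.recur = Γ.F := by
  choose g hg using hΓ
  refine Set.Subset.antisymm (fun v hv => hv.1) fun v hv => ⟨hv, positional g, ?_⟩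
  exact Game.isWinningFrom_positional hwin (fun v _ => hg v) v

/-- The exact attractor distance is unique, so a single choice of a successor serves all `n`. -/
theorem exists_edge_attr_decreasing (hΓ : Relator.LeftTotal Γ.E) (T : Set V) {v : V}
    (hv : v ∈ Γ.V₀) :
    ∃ u, Γ.E v u ∧ ∀ n, v ∈ Γ.attr T (n + 1) → v ∉ Γ.attr T n → u ∈ Γ.attr T n := by
  by_cases hn : ∃ n, v ∈ Γ.attr T (n + 1) ∧ v ∉ Γ.attr T n
  · obtain ⟨n, (h | ⟨-, u, hu, h⟩) | ⟨h, -⟩, hvn⟩ := hn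
    · exact absurd h hvn
    · refine ⟨u, hu, fun m hm _ => ?_⟩
      rcases le_or_gt n m with hnm | hmn
      · exact Γ.attr_mono T hnm h
      · exact absurd (Γ.attr_mono T hmn hm) hvn
    · exact absurd hv h
  · obtain ⟨u, hu⟩ := hΓ v
    exact ⟨u, hu, fun n h h' => absurd ⟨n, h, h'⟩ hn⟩

theorem exists_isAttractorStrategy (hΓ : Relator.LeftTotal Γ.E)
    (hattr : ∀ v, ∃ n, v ∈ Γ.attr Γ.recur n) : ∃ g, Γ.IsAttractorStrategy g := by
  have hsucc : ∀ v, ∃ u, v ∈ Γ.V₀ → Γ.E v u ∧ ∀ n, v ∈ Γ.attr Γ.recur (n + 1) →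
      v ∉ Γ.attr Γ.recur n → u ∈ Γ.attr Γ.recur n := fun v => by
    by_cases hv : v ∈ Γ.V₀
    · obtain ⟨u, hu⟩ := exists_edge_attr_decreasing hΓ Γ.recur hv
      exact ⟨u, fun _ => hu⟩
    · exact ⟨v, fun h => absurd h hv⟩
  choose g hg using hsucc
  exact ⟨g, fun v hv => (hg v hv).1, fun v hv => (hg v hv).2, fun v _ _ => hattr (g v)⟩

end BuchiGame

/-! ### Simulation games and closures -/

/-- Bisimulation relations between the states of a labelled transition system. Unlike
`BuchiAutomaton.DirectBisim`, the notion does not refer to final states. -/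
structure IsBisimulation {Q A : Type} (Δ : Q → A → Q → Prop) (R : Q → Q → Prop) : Prop where
  forth : ∀ {q q' a p}, R q q' → Δ q a p → ∃ p', Δ q' a p' ∧ R p p'
  back : ∀ {q q' a p'}, R q q' → Δ q' a p' → ∃ p, Δ q a p ∧ R p p'

namespace IsBisimulation

variable {Q A : Type} {Δ : Q → A → Q → Prop} {R : Q → Q → Prop}

theorem exists_answer (hR : IsBisimulation Δ R) (m : SpoilerMove Q A) {c : Q × Q} (hc : R c.1 c.2)
    (hm : Δ (side m.1 c) m.2.1 m.2.2) :
    ∃ p, Δ (side (!m.1) c) m.2.1 p ∧ if m.1 then R p m.2.2 else R m.2.2 p := by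
  obtain ⟨_ | _, a, p⟩ := m
  · exact hR.forth hc hm
  · exact hR.back hc hm

/-- Duplicator keeps the two runs related, whichever of them Spoiler extends. -/
theorem duplicatorWins (hR : IsBisimulation Δ R) (sides : Set Bool)
    {W : (ℕ → Q) → (ℕ → Q) → Prop}
    (hW : ∀ ρ ρ', (∀ n, ∃ a, Δ (ρ n) a (ρ (n + 1)) ∧ Δ (ρ' n) a (ρ' (n + 1))) →
      (∀ n, R (ρ n) (ρ' n)) → W ρ ρ')
    {q q' : Q} (hq : R q q') : DuplicatorWins Δ sides W q q' := by
  have hanswer : ∀ (m : SpoilerMove Q A) (c : Q × Q), ∃ p, R c.1 c.2 →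
      Δ (side m.1 c) m.2.1 m.2.2 →
      Δ (side (!m.1) c) m.2.1 p ∧ if m.1 then R p m.2.2 else R m.2.2 p := fun m c => by
    by_cases h : R c.1 c.2 ∧ Δ (side m.1 c) m.2.1 m.2.2
    · exact (hR.exists_answer m h.1 h.2).imp fun _ hp _ _ => hp
    · exact ⟨m.2.2, fun h₁ h₂ => absurd ⟨h₁, h₂⟩ h⟩
  choose answer hanswer using hanswer
  let pos : List (SpoilerMove Q A) → Q × Q := List.foldr
    (fun m c => if m.1 then (answer m c, m.2.2) else (m.2.2, answer m c)) (q, q')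
  let d : List (SpoilerMove Q A) → Q
    | [] => q
    | m :: h => answer m (pos h)
  have positions_eq : ∀ h, positions d q q' h = pos h := by
    rintro (_ | ⟨⟨_ | _, a, p⟩, h⟩) <;> rfl
  have related : ∀ h, IsHistory Δ sides d q q' h → R (pos h).1 (pos h).2 := by
    intro h
    induction h with
    | nil => exact fun _ => hq
    | cons m h ih =>
      rintro ⟨hh, -, hm⟩
      have hp := (hanswer m (pos h) (ih hh) (positions_eq h ▸ hm)).2
      obtain ⟨_ | _, a, p⟩ := m <;> exact hp
  have legal : ∀ m h, IsHistory Δ sides d q q' (m :: h) →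
      Δ (side (!m.1) (positions d q q' h)) m.2.1 (d (m :: h)) := fun m h hm => by
    rw [positions_eq]
    exact (hanswer m (pos h) (related h hm.1) (positions_eq h ▸ hm.2.2)).1
  refine ⟨d, legal, fun μ hμ => hW _ _ (fun n => ⟨(μ n).2.1, ?_⟩) fun n => ?_⟩
  · have hspoiler := (hμ (n + 1)).2.2
    have hduplicator := legal _ _ (hμ (n + 1))
    simp only [histOf] at hspoiler hduplicator ⊢
    generalize μ n = m at hspoiler hduplicator ⊢
    obtain ⟨_ | _, a, p⟩ := m
    exacts [⟨hspoiler, hduplicator⟩, ⟨hduplicator, hspoiler⟩]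
  · simpa only [positions_eq] using related _ (hμ n)

end IsBisimulation

theorem IsRankingFunction.inClosure {Q A : Type} {α : Type*} [Preorder α] [WellFoundedLT α]
    {B : BuchiAutomaton Q A} {Φ : Q → α}
    (hΦ : IsRankingFunction (fun q q' => ∃ a, B.Δ q a q') B.F Φ) (q : Q) : B.InClosure q := by
  induction h : Φ q using WellFoundedLT.induction generalizing q with
  | _ n ih =>
    refine .step q fun a q' hq' => ?_
    rcases hΦ q q' ⟨a, hq'⟩ with hlt | hF
    · exact ih (Φ q') (h ▸ hlt) q' rfl
    · exact .base q' hF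

namespace BuchiAutomaton

variable {Q A : Type} {B : BuchiAutomaton Q A} {R : Q → Q → Prop} {q q' : Q}

theorem directBisim_of_F_eq_univ (hF : B.F = Set.univ) (hR : IsBisimulation B.Δ R) (hq : R q q') :
    B.DirectBisim q q' :=
  hR.duplicatorWins _ (fun ρ ρ' _ _ n => by simp only [hF, Set.mem_univ]) hq

theorem delayedSim_of_frequently_mem
    (hfreq : ∀ ρ : ℕ → Q, (∀ n, ∃ a, B.Δ (ρ n) a (ρ (n + 1))) → ∃ᶠ n in atTop, ρ n ∈ B.F)
    (hR : IsBisimulation B.Δ R) (hq : R q q') : B.DelayedSim q q' :=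
  hR.duplicatorWins _ (fun _ ρ' hρ _ n _ =>
    frequently_atTop.1 (hfreq ρ' fun m => (hρ m).imp fun _ ha => ha.2) n) hq

end BuchiAutomaton

theorem card_quotient_memSetoid {S V : Type} [Nonempty S] {r : Setoid (S × V)}
    (h : ∀ s s' v, r (s, v) (s', v)) : Nat.card (Quotient (memSetoid r)) = 1 := by
  rw [Nat.card_eq_one_iff_unique]
  exact ⟨⟨Quotient.ind₂ fun s s' => Quotient.sound (h s s')⟩, Nonempty.map (Quotient.mk _) ‹_›⟩

/-! ### The memory reduction of request-response games with a ranking function -/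

namespace RRGame

variable {V : Type} {K : ℕ} [NeZero K] {Γ : RRGame V K}

theorem automaton_init_iff {v : V} {q : LiveState (RRMemory K) V} :
    Γ.automaton.Δ Γ.automaton.init v q ↔ q = LiveState.mem (RRMemory.start K) v := by
  constructor
  · intro h
    obtain ⟨q, hq⟩ := q
    change gaStep _ _ _ GAState.init v q at h
    cases h
    rfl
  · rintro rfl
    exact gaStep.init v

theorem automaton_mem_iff {s : RRMemory K} {u v : V} {q : LiveState (RRMemory K) V} :
    Γ.automaton.Δ (LiveState.mem s u) v q ↔ Γ.E u v ∧ q = LiveState.mem (Γ.update s u) v := by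
  constructor
  · intro h
    obtain ⟨q, hq⟩ := q
    change gaStep _ _ _ (GAState.mem s u) v q at h
    cases h with
    | edge _ _ _ _ h =>
      obtain ⟨rfl, huv⟩ := h
      exact ⟨huv, rfl⟩
    | noEdge => exact absurd rfl hq
  · rintro ⟨huv, rfl⟩
    exact gaStep.edge _ _ _ _ ⟨rfl, huv⟩

theorem mem_automaton_F_iff {s : RRMemory K} {v : V} :
    LiveState.mem s v ∈ Γ.automaton.F ↔ (s, v) ∈ Γ.buchi.F := by
  constructor
  · rintro ⟨s', v', h, hF⟩
    cases h
    exact hF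
  · exact fun hF => ⟨s, v, rfl, hF⟩

theorem liveState_cases (q : LiveState (RRMemory K) V) :
    q = Γ.automaton.init ∨ ∃ s v, q = LiveState.mem s v := by
  obtain ⟨_ | ⟨s, v⟩ | _, hq⟩ := q
  exacts [Or.inl rfl, Or.inr ⟨s, v, rfl⟩, absurd rfl hq]

theorem isBisimulation_vertex_eq :
    IsBisimulation Γ.automaton.Δ fun q q' => q.1.vertex? = q'.1.vertex? := by
  have forth : ∀ {q q' p : LiveState (RRMemory K) V} {v : V}, q.1.vertex? = q'.1.vertex? →
      Γ.automaton.Δ q v p → ∃ p', Γ.automaton.Δ q' v p' ∧ p.1.vertex? = p'.1.vertex? := by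
    intro q q' p v hq hp
    rcases Γ.liveState_cases q with rfl | ⟨s, u, rfl⟩ <;>
      rcases Γ.liveState_cases q' with rfl | ⟨s', u', rfl⟩
    · exact ⟨p, hp, rfl⟩
    · exact absurd hq (Option.some_ne_none u').symm
    · exact absurd hq (Option.some_ne_none u)
    · obtain rfl : u = u' := Option.some_injective _ hq
      obtain ⟨huv, rfl⟩ := automaton_mem_iff.1 hp
      exact ⟨_, automaton_mem_iff.2 ⟨huv, rfl⟩, rfl⟩
  exact ⟨forth, fun hq hp => (forth hq.symm hp).imp fun _ h => ⟨h.1, h.2.symm⟩⟩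

/-- The rank of a state of the game automaton, given ranks of the pairs of a memory content and a
vertex. The initial state, which no transition enters, has rank `⊤`. -/
def stateRank {S α : Type} (Φ : S × V → α) (q : LiveState S V) : WithTop α :=
  match q.1 with
  | .mem s v => Φ (s, v)
  | _ => ⊤

variable {α : Type} [Preorder α] {Φ : RRMemory K × V → α}

theorem isRankingFunction_stateRank (hΦ : IsRankingFunction Γ.buchi.E Γ.buchi.F Φ) :
    IsRankingFunction (fun q q' => ∃ v, Γ.automaton.Δ q v q') Γ.automaton.F (stateRank Φ) := by
  rintro q q' ⟨v, h⟩
  rcases Γ.liveState_cases q with rfl | ⟨s, u, rfl⟩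
  · rw [automaton_init_iff.1 h]
    exact Or.inl (WithTop.coe_lt_top _)
  · obtain ⟨huv, rfl⟩ := automaton_mem_iff.1 h
    rw [mem_automaton_F_iff]
    exact (hΦ (s, u) (Γ.update s u, v) ⟨rfl, huv⟩).imp_left WithTop.coe_lt_coe.2

variable [WellFoundedLT α]

theorem closure_F_eq_univ (hΦ : IsRankingFunction Γ.buchi.E Γ.buchi.F Φ) :
    Γ.automaton.closure.F = Set.univ :=
  Set.eq_univ_of_forall (isRankingFunction_stateRank hΦ).inClosure

theorem card_memoryReduction_mem (hΦ : IsRankingFunction Γ.buchi.E Γ.buchi.F Φ)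
    (prec : RRMemory K → RRMemory K → Prop) : Nat.card (Γ.memoryReduction prec).Mem = 1 :=
  haveI : Nonempty (RRMemory K) := ⟨RRMemory.start K⟩
  card_quotient_memSetoid fun _ _ _ =>
    BuchiAutomaton.directBisim_of_F_eq_univ (closure_F_eq_univ hΦ) Γ.isBisimulation_vertex_eq rfl

theorem card_delayedReduction_mem (hΦ : IsRankingFunction Γ.buchi.E Γ.buchi.F Φ)
    (prec : RRMemory K → RRMemory K → Prop) : Nat.card (Γ.delayedReduction prec).Mem = 1 := by
  have : Nonempty (RRMemory K) := ⟨RRMemory.start K⟩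
  have hsim : ∀ q q' : LiveState (RRMemory K) V, q.1.vertex? = q'.1.vertex? →
      Γ.automaton.DelayedSim q q' := fun q q' =>
    BuchiAutomaton.delayedSim_of_frequently_mem
      (fun ρ hρ => (isRankingFunction_stateRank hΦ).frequently_mem hρ) Γ.isBisimulation_vertex_eq
  exact card_quotient_memSetoid fun _ _ _ => ⟨hsim _ _ rfl, hsim _ _ rfl⟩

end RRGame

/-! ### The simulation of request-response games by Büchi games -/

theorem past_succ {V : Type} (ρ : ℕ → V) (n : ℕ) : past ρ (n + 1) = past ρ n ++ [ρ n] := by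
  simp [past, List.range_succ]

namespace RRGame

variable {V : Type} {K : ℕ} [NeZero K] {Γ : RRGame V K}

theorem leftTotal_buchi (hΓ : Relator.LeftTotal Γ.E) : Relator.LeftTotal Γ.buchi.E := fun q =>
  (hΓ q.2).imp' (Γ.update q.1 q.2, ·) fun _ h => ⟨rfl, h⟩

section Marker

variable {s : RRMemory K} {u : V}

theorem marker_of_mem (h : s.2.1 ∈ Γ.openRequests s u) : Γ.marker s u = s.2.1 :=
  if_pos h

theorem marker_of_notMem (h : s.2.1 ∉ Γ.openRequests s u) : Γ.marker s u = s.2.1 + 1 :=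
  if_neg h

variable (Γ s u) in
theorem val_marker_le : (Γ.marker s u : ℕ) ≤ s.2.1 + 1 := by
  by_cases h : s.2.1 ∈ Γ.openRequests s u
  · rw [marker_of_mem h]
    exact Nat.le_succ _
  · rw [marker_of_notMem h, Fin.val_add]
    exact (Nat.mod_le _ _).trans (Nat.add_le_add_left (Fin.val_one' K ▸ Nat.mod_le 1 K) _)

theorem update_flag_eq_true_iff :
    (Γ.update s u).2.2 = true ↔ (s.2.1 : ℕ) + 1 = K ∧ Γ.marker s u = 0 :=
  decide_eq_true_iff

theorem update_flag_eq_false (h : (s.2.1 : ℕ) + 1 < K) : (Γ.update s u).2.2 = false :=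
  decide_eq_false fun h' => h.ne h'.1

theorem update_eq_of_mem (h : s.2.1 ∈ Γ.openRequests s u) (hs : (s.2.1 : ℕ) + 1 < K) :
    Γ.update s u = (Γ.openRequests s u, s.2.1, false) :=
  Prod.ext rfl (Prod.ext (marker_of_mem h) (update_flag_eq_false hs))

theorem update_eq_of_notMem (h : s.2.1 ∉ Γ.openRequests s u) (hs : (s.2.1 : ℕ) + 1 < K) :
    Γ.update s u = (Γ.openRequests s u, s.2.1 + 1, false) :=
  Prod.ext rfl (Prod.ext (marker_of_notMem h) (update_flag_eq_false hs))

theorem marker_le_of_mem {j : Fin K} (hj : j ∈ Γ.openRequests s u) (hs : s.2.1 ≤ j) :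
    Γ.marker s u ≤ j := by
  rcases hs.eq_or_lt with rfl | hlt
  · exact (marker_of_mem hj).le
  · exact Fin.le_def.2 ((Γ.val_marker_le s u).trans hlt)

/-- For `K = 1` this fails: the marker is always `0`, and the flag is set even if the marker does
not move. -/
theorem update_flag_eq_false_of_mem (hK : 1 < K) {j : Fin K} (hj : j ∈ Γ.openRequests s u)
    (hs : s.2.1 ≤ j) : (Γ.update s u).2.2 = false := by
  refine decide_eq_false fun ⟨hlast, hzero⟩ => ?_
  obtain rfl : s.2.1 = j := Fin.ext (by have := Fin.le_def.1 hs; omega)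
  have hval := congrArg Fin.val (marker_of_mem hj ▸ hzero)
  exact hK.ne (by rw [← hlast, hval, Fin.val_zero])

end Marker

/-- The sequence of the vertices of `ρ`, paired with the memory contents of the simulating Büchi
game: for a play `ρ`, this is the play of the Büchi game from the initial memory content that
simulates it. -/
noncomputable def lift (Γ : RRGame V K) (ρ : ℕ → V) (n : ℕ) : RRMemory K × V :=
  ((past ρ n).foldl Γ.update (RRMemory.start K), ρ n)

variable {ρ : ℕ → V}

theorem lift_succ (n : ℕ) : Γ.lift ρ (n + 1) = (Γ.update (Γ.lift ρ n).1 (ρ n), ρ (n + 1)) := by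
  simp only [lift, past_succ, List.foldl_append, List.foldl_cons, List.foldl_nil]

theorem isPath_lift (hρ : Γ.IsPath ρ) : Γ.buchi.IsPath (Γ.lift ρ) := fun n => by
  rw [lift_succ]
  exact ⟨rfl, hρ n⟩

theorem eq_lift {ρ' : ℕ → RRMemory K × V} (hρ' : Γ.buchi.IsPath ρ')
    (hstart : ρ' 0 = (RRMemory.start K, ρ 0)) (hsnd : ∀ n, (ρ' n).2 = ρ n) : ρ' = Γ.lift ρ := by
  funext n
  induction n with
  | zero => exact hstart
  | succ n ih =>
    rw [lift_succ, ← ih, ← hsnd n]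
    exact Prod.ext (hρ' n).1 (hsnd (n + 1))

theorem mem_lift_succ_iff {j : Fin K} {n : ℕ} :
    j ∈ (Γ.lift ρ (n + 1)).1.1 ↔ (j ∈ (Γ.lift ρ n).1.1 ∨ ρ n ∈ Γ.P j) ∧ ρ n ∉ Γ.R j := by
  rw [lift_succ]
  rfl

theorem mem_lift_iff {j : Fin K} {n : ℕ} :
    j ∈ (Γ.lift ρ n).1.1 ↔
      ∃ i < n, ρ i ∈ Γ.P j ∧ ∀ i', i ≤ i' → i' < n → ρ i' ∉ Γ.R j := by
  induction n with
  | zero => exact iff_of_false id fun ⟨i, hi, _⟩ => absurd hi (Nat.not_lt_zero i)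
  | succ n ih =>
    rw [mem_lift_succ_iff, ih]
    constructor
    · rintro ⟨⟨i, hi, hP, hR⟩ | hP, hn⟩
      · refine ⟨i, hi.trans n.lt_succ_self, hP, fun i' hi' hlt => ?_⟩
        rcases Nat.lt_succ_iff_lt_or_eq.1 hlt with h | rfl
        exacts [hR i' hi' h, hn]
      · refine ⟨n, n.lt_succ_self, hP, fun i' hi' hlt => ?_⟩
        rwa [Nat.le_antisymm (Nat.lt_succ_iff.1 hlt) hi']
    · rintro ⟨i, hi, hP, hR⟩
      refine ⟨?_, hR n (Nat.lt_succ_iff.1 hi) n.lt_succ_self⟩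
      rcases Nat.lt_succ_iff_lt_or_eq.1 hi with h | rfl
      · exact Or.inl ⟨i, h, hP, fun i' hi' hlt => hR i' hi' (hlt.trans n.lt_succ_self)⟩
      · exact Or.inr hP

theorem mem_win_iff_frequently_notMem :
    ρ ∈ Γ.toGame.win ↔ ∀ j, ∃ᶠ n in atTop, j ∉ (Γ.lift ρ n).1.1 := by
  simp only [frequently_atTop]
  constructor
  · intro hwin j n
    by_contra! hopen
    obtain ⟨i, -, hP, hR⟩ := mem_lift_iff.1 (hopen n le_rfl)
    obtain ⟨i', hi', hanswer⟩ := hwin j i hP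
    have hn : n ≤ i' := not_lt.1 fun h => hR i' hi' h hanswer
    exact (mem_lift_succ_iff.1 (hopen (i' + 1) (hn.trans i'.le_succ))).2 hanswer
  · intro hclosed j i hP
    obtain ⟨n, hn, hnot⟩ := hclosed j (i + 1)
    by_contra! hR
    exact hnot (mem_lift_iff.2 ⟨i, hn, hP, fun i' hi' _ => hR i' hi'⟩)

theorem flag_lift_succ_iff {n : ℕ} : (Γ.lift ρ (n + 1)).1.2.2 = true ↔
    ((Γ.lift ρ n).1.2.1 : ℕ) + 1 = K ∧ (Γ.lift ρ (n + 1)).1.2.1 = 0 := by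
  rw [lift_succ]
  exact update_flag_eq_true_iff

/-- The marker leaves the current request as soon as it is not open. -/
theorem exists_marker_lift_advances (h : ∀ j, ∃ᶠ n in atTop, j ∉ (Γ.lift ρ n).1.1) (n : ℕ) :
    ∃ m, n ≤ m ∧ (Γ.lift ρ m).1.2.1 = (Γ.lift ρ n).1.2.1 ∧
      (Γ.lift ρ (m + 1)).1.2.1 = (Γ.lift ρ n).1.2.1 + 1 := by
  set j := (Γ.lift ρ n).1.2.1 with hj
  suffices ∃ m, n ≤ m ∧ (Γ.lift ρ m).1.2.1 = j ∧ j ∉ (Γ.lift ρ (m + 1)).1.1 by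
    obtain ⟨m, hm, hmarker, hnot⟩ := this
    refine ⟨m, hm, hmarker, ?_⟩
    rw [lift_succ] at hnot ⊢
    rw [← hmarker] at hnot ⊢
    exact marker_of_notMem hnot
  by_contra! hopen
  have hstuck : ∀ m, n ≤ m → (Γ.lift ρ m).1.2.1 = j := fun m hm => by
    induction m, hm using Nat.le_induction with
    | base => exact hj.symm
    | succ m hm ih =>
      have hmem := hopen m hm ih
      rw [lift_succ] at hmem ⊢
      rw [← ih] at hmem ⊢
      exact marker_of_mem hmem
  obtain ⟨m, hm, hnot⟩ := frequently_atTop.1 (h j) (n + 1)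
  obtain ⟨m, rfl⟩ := Nat.exists_eq_add_one_of_ne_zero (by omega : m ≠ 0)
  exact hnot (hopen m (by omega) (hstuck m (by omega)))

theorem frequently_flag_lift (h : ∀ j, ∃ᶠ n in atTop, j ∉ (Γ.lift ρ n).1.1) :
    ∃ᶠ n in atTop, (Γ.lift ρ n).1.2.2 = true := by
  rw [frequently_atTop]
  intro n
  induction hd : K - (Γ.lift ρ n).1.2.1 using Nat.strong_induction_on generalizing n with
  | _ d ih =>
    obtain ⟨m, hm, hmarker, hmarker_succ⟩ := exists_marker_lift_advances h n
    have hlt := (Γ.lift ρ n).1.2.1.isLt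
    rcases (Nat.add_one_le_iff.2 hlt).eq_or_lt with hlast | hlast
    · refine ⟨m + 1, by omega, flag_lift_succ_iff.2 ⟨hmarker ▸ hlast, hmarker_succ.trans ?_⟩⟩
      exact Fin.ext (by
        rw [Fin.val_add, Fin.val_one', Nat.add_mod_mod, hlast, Nat.mod_self, Fin.val_zero])
    · have hval : ((Γ.lift ρ (m + 1)).1.2.1 : ℕ) = (Γ.lift ρ n).1.2.1 + 1 := by
        rw [hmarker_succ, Fin.val_add_one_of_lt' hlast]
      obtain ⟨l, hl, hflag⟩ := ih _ (by omega) (m + 1) rfl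
      exact ⟨l, by omega, hflag⟩

/-- The marker never passes the index of a request that stays open. -/
theorem flag_lift_eq_false_of_forall_mem (hK : 1 < K) {j : Fin K} {n : ℕ}
    (hopen : ∀ m, n ≤ m → j ∈ (Γ.lift ρ m).1.1) (hj : (Γ.lift ρ n).1.2.1 ≤ j) (m : ℕ)
    (hm : n < m) : (Γ.lift ρ m).1.2.2 = false := by
  have hmem : ∀ m, n ≤ m → j ∈ Γ.openRequests (Γ.lift ρ m).1 (ρ m) := fun m hm => by
    have hmem := hopen (m + 1) (by omega)
    rw [lift_succ] at hmem
    exact hmem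
  have hmarker : ∀ m, n ≤ m → (Γ.lift ρ m).1.2.1 ≤ j := fun m hm => by
    induction m, hm using Nat.le_induction with
    | base => exact hj
    | succ m hm ih =>
      rw [lift_succ]
      exact marker_le_of_mem (hmem m hm) ih
  obtain ⟨m, rfl⟩ := Nat.exists_eq_add_one_of_ne_zero (by omega : m ≠ 0)
  rw [lift_succ]
  exact update_flag_eq_false_of_mem hK (hmem m (by omega)) (hmarker m (by omega))

theorem marker_lift_eq_zero_of_flag {n : ℕ} (h : (Γ.lift ρ n).1.2.2 = true) :
    (Γ.lift ρ n).1.2.1 = 0 := by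
  cases n with
  | zero => rfl
  | succ n => exact (flag_lift_succ_iff.1 h).2

theorem mem_win_iff_frequently_flag (hK : 1 < K) :
    ρ ∈ Γ.toGame.win ↔ ∃ᶠ n in atTop, (Γ.lift ρ n).1.2.2 = true := by
  rw [mem_win_iff_frequently_notMem]
  refine ⟨frequently_flag_lift, fun hflag j => ?_⟩
  by_contra hopen
  obtain ⟨N, hN⟩ := eventually_atTop.1 (not_frequently.1 hopen)
  obtain ⟨n, hn, hn_flag⟩ := frequently_atTop.1 hflag N
  obtain ⟨m, hm, hm_flag⟩ := frequently_atTop.1 hflag (n + 1)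
  have hfalse := flag_lift_eq_false_of_forall_mem hK
    (fun m hm => not_not.1 (hN m (hn.trans hm)))
    (by rw [marker_lift_eq_zero_of_flag hn_flag]; exact Fin.zero_le _) m hm
  exact absurd hm_flag (by rw [hfalse]; exact Bool.false_ne_true)

theorem simulates_buchi (hK : 1 < K) (Γ : RRGame V K) :
    Simulates Γ.toGame (RRMemory.start K) Γ.buchi.toGame where
  owner _ _ := Iff.rfl
  exists_update s v _ hE := ⟨Γ.update s v, rfl, hE⟩
  unique_update _ _ _ _ _ _ h₁ h₂ := h₁.1.trans h₂.1.symm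
  edge _ _ _ _ h := h.2
  win_iff ρ ρ' _ hρ' hstart hsnd := by
    rw [eq_lift hρ' hstart hsnd]
    exact mem_win_iff_frequently_flag hK

theorem isWinningFrom_strategyAutomaton (hK : 1 < K) {g : RRMemory K × V → RRMemory K × V} {v : V}
    (hg : Γ.buchi.toGame.IsWinningFrom (positional g) (RRMemory.start K, v)) :
    Γ.toGame.IsWinningFrom (Γ.strategyAutomaton g).toStrategy v := by
  have hedge : ∀ q ∈ Γ.buchi.V₀, Γ.buchi.E q (g q) := fun q hq =>
    hg.1 [] q hq (List.isChain_singleton q)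
  refine ⟨fun h u hu _ => (hedge (_, u) hu).2, fun ρ hρ hstart hconf => ?_⟩
  refine (mem_win_iff_frequently_flag hK).2
    (hg.2 (Γ.lift ρ) (isPath_lift hρ) (congrArg (RRMemory.start K, ·) hstart) fun n hn => ?_)
  rw [lift_succ]
  exact Prod.ext (hedge _ hn).1.symm (hconf n hn)

section Distance

variable {s : RRMemory K} {u : V} {n : ℕ}

theorem notMem_buchi_F_of_flag (hflag : s.2.2 = false) : (s, u) ∉ Γ.buchi.F :=
  fun h => Bool.false_ne_true (hflag.symm.trans h)

theorem mem_avoiding_of_marker_add_lt (hflag : s.2.2 = false) (hs : s.2.1 + n < K) :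
    (s, u) ∈ Γ.buchi.avoiding Γ.buchi.F (n + 1) := by
  induction n generalizing s u with
  | zero => exact ⟨notMem_buchi_F_of_flag hflag, fun _ _ => Set.mem_univ _⟩
  | succ n ih =>
    refine ⟨notMem_buchi_F_of_flag hflag, ?_⟩
    rintro ⟨s', u'⟩ ⟨rfl, -⟩
    have hflag' := update_flag_eq_false (Γ := Γ) (s := s) (u := u) (by omega)
    refine ih hflag' ?_
    have := Γ.val_marker_le s u
    change (Γ.marker s u : ℕ) + n < K
    omega

theorem mem_avoiding_of_open (hK : 1 < K) {j : Fin K} (hj : j ∈ s.1) (hs : s.2.1 ≤ j)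
    (hflag : s.2.2 = false) (hu : u ∈ Γ.avoiding (Γ.R j) n) :
    (s, u) ∈ Γ.buchi.avoiding Γ.buchi.F (n + 1) := by
  induction n generalizing s u with
  | zero => exact ⟨notMem_buchi_F_of_flag hflag, fun _ _ => Set.mem_univ _⟩
  | succ n ih =>
    refine ⟨notMem_buchi_F_of_flag hflag, ?_⟩
    rintro ⟨s', u'⟩ ⟨rfl, hE⟩
    have hj' : j ∈ Γ.openRequests s u := ⟨Or.inl hj, hu.1⟩
    have hflag' := update_flag_eq_false_of_mem hK hj' hs
    exact ih hj' (marker_le_of_mem hj' hs) hflag' (hu.2 u' hE)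

end Distance

end RRGame

/-! ### Implementations of strategies -/

theorem Mealy.Implements.eq_of_state_eq {V : Type} {M : Type*} {C : Mealy V M} {G : Arena V}
    {f : Strategy V} {v : V} (hC : C.Implements G f v) {ρ ρ' : ℕ → V} (hρ : G.IsPath ρ)
    (hρ' : G.IsPath ρ') (hstart : ρ 0 = v) (hstart' : ρ' 0 = v) (hconf : G.Conforms f ρ)
    (hconf' : G.Conforms f ρ') {n : ℕ}
    (hstate : (past ρ n).foldl C.step C.init = (past ρ' n).foldl C.step C.init)
    (hn : ρ n = ρ' n)
    (hdet : ∀ m, n ≤ m → ρ m ∉ G.V₀ → ∀ u u', G.E (ρ m) u → G.E (ρ m) u' → u = u')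
    (m : ℕ) (hm : n ≤ m) : ρ m = ρ' m := by
  suffices (past ρ m).foldl C.step C.init = (past ρ' m).foldl C.step C.init ∧ ρ m = ρ' m from this.2
  induction m, hm using Nat.le_induction with
  | base => exact ⟨hstate, hn⟩
  | succ m hm ih =>
    obtain ⟨hfold, heq⟩ := ih
    constructor
    · simp only [past_succ, List.foldl_append, List.foldl_cons, List.foldl_nil, hfold, heq]
    by_cases h₀ : ρ m ∈ G.V₀
    · rw [hconf m h₀, hconf' m (heq ▸ h₀), ← hC ρ hρ hstart hconf m h₀,
        ← hC ρ' hρ' hstart' hconf' m (heq ▸ h₀), Mealy.toStrategy, Mealy.toStrategy, hfold, heq]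
    · exact hdet m hm h₀ _ _ (hρ m) (heq ▸ hρ' m)

/-! ### The game graphs `G_k` -/

namespace Vertex

variable {k : ℕ}

/-- The request vertices: `p i` for `c = true` and `p' i` for `c = false`. -/
def request (c : Bool) (i : Fin k) : Vertex k :=
  match c with
  | true => p i
  | false => p' i

/-- The response vertices: `r i` for `c = true` and `r' i` for `c = false`. -/
def response (c : Bool) (i : Fin k) : Vertex k :=
  match c with
  | true => r i
  | false => r' i

theorem response_left_injective (i : Fin k) :
    Function.Injective fun c : Bool => (response c i : Vertex k) := by
  rintro (_ | _) (_ | _) h <;> first | rfl | cases h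

/-- The sequence `a 0, …, a (k - 1), w 0` of the vertices between the requests. -/
def aAt [NeZero k] (i : ℕ) : Vertex k :=
  if h : i < k then a ⟨i, h⟩ else w 0

/-- The sequence `w 0, …, w (k - 1), x` of the vertices between the responses. -/
def wAt (i : ℕ) : Vertex k :=
  if h : i < k then w ⟨i, h⟩ else x

theorem aAt_of_lt [NeZero k] {i : ℕ} (h : i < k) : aAt i = a ⟨i, h⟩ :=
  dif_pos h

theorem wAt_of_lt {i : ℕ} (h : i < k) : wAt i = w ⟨i, h⟩ :=
  dif_pos h

theorem wAt_self : (wAt k : Vertex k) = x :=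
  dif_neg k.lt_irrefl

theorem aAt_self [NeZero k] : (aAt k : Vertex k) = wAt 0 := by
  rw [wAt_of_lt (NeZero.pos k)]
  exact dif_neg k.lt_irrefl

theorem edge_a_iff {i : Fin k} {u : Vertex k} : Edge (a i) u ↔ ∃ c, u = request c i := by
  constructor
  · rintro (_ | _)
    exacts [⟨true, rfl⟩, ⟨false, rfl⟩]
  · rintro ⟨_ | _, rfl⟩
    exacts [.request' i, .request i]

theorem edge_w_iff {i : Fin k} {u : Vertex k} : Edge (w i) u ↔ ∃ c, u = response c i := by
  constructor
  · rintro (_ | _)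
    exacts [⟨true, rfl⟩, ⟨false, rfl⟩]
  · rintro ⟨_ | _, rfl⟩
    exacts [.response' i, .response i]

theorem edge_x_iff {u : Vertex k} : Edge x u ↔ u = y :=
  ⟨by rintro ⟨⟩; rfl, by rintro rfl; exact .last⟩

theorem edge_y_iff {u : Vertex k} : Edge y u ↔ u = y :=
  ⟨by rintro ⟨⟩; rfl, by rintro rfl; exact .loop⟩

theorem edge_request_iff [NeZero k] {c : Bool} {i : Fin k} {u : Vertex k} :
    Edge (request c i) u ↔ u = aAt (i + 1) := by
  constructor
  · intro h
    rw [aAt]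
    cases c with
    | false =>
      cases h with
      | next' _ j hj => rw [dif_pos (hj ▸ j.isLt)]; exact congrArg a (Fin.ext hj)
      | switch' _ j hi hj => rw [dif_neg hi.not_lt]; exact congrArg w (Fin.ext hj)
    | true =>
      cases h with
      | next _ j hj => rw [dif_pos (hj ▸ j.isLt)]; exact congrArg a (Fin.ext hj)
      | switch _ j hi hj => rw [dif_neg hi.not_lt]; exact congrArg w (Fin.ext hj)
  · rintro rfl
    rw [aAt]
    split_ifs with h <;> cases c
    · exact .next' i _ rfl
    · exact .next i _ rfl
    · exact .switch' i 0 (by omega) (Fin.val_zero _)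
    · exact .switch i 0 (by omega) rfl

theorem edge_response_iff {c : Bool} {i : Fin k} {u : Vertex k} :
    Edge (response c i) u ↔ u = wAt (i + 1) := by
  constructor
  · intro h
    rw [wAt]
    cases c with
    | false =>
      cases h with
      | onward' _ j hj => rw [dif_pos (hj ▸ j.isLt)]; exact congrArg w (Fin.ext hj)
      | finish' _ hi => rw [dif_neg hi.not_lt]
    | true =>
      cases h with
      | onward _ j hj => rw [dif_pos (hj ▸ j.isLt)]; exact congrArg w (Fin.ext hj)
      | finish _ hi => rw [dif_neg hi.not_lt]
  · rintro rfl
    rw [wAt]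
    split_ifs with h <;> cases c
    · exact .onward' i _ rfl
    · exact .onward i _ rfl
    · exact .finish' i (by omega)
    · exact .finish i (by omega)

/-- Distinguishes the types of vertices, without the case distinction between the two requests and
between the two responses with the same index. -/
@[elab_as_elim]
theorem typeCases {motive : Vertex k → Prop} (u : Vertex k) (a : ∀ i, motive (a i))
    (request : ∀ c i, motive (request c i)) (w : ∀ i, motive (w i))
    (response : ∀ c i, motive (response c i)) (x : motive x) (y : motive y) : motive u := by
  cases u with
  | a i => exact a i
  | p i => exact request true i
  | p' i => exact request false i
  | w i => exact w i
  | r i => exact response true i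
  | r' i => exact response false i
  | x => exact x
  | y => exact y

/-- The number of moves before the vertex `y` is reached. -/
def rank : Vertex k → ℕ
  | a i => 4 * k + 1 - 2 * i
  | p i | p' i => 4 * k - 2 * i
  | w i => 2 * k + 1 - 2 * i
  | r i | r' i => 2 * k - 2 * i
  | x => 1
  | y => 0

theorem rank_request (c : Bool) (i : Fin k) : (request c i).rank = 4 * k - 2 * i := by
  cases c <;> rfl

theorem rank_response (c : Bool) (i : Fin k) : (response c i).rank = 2 * k - 2 * i := by
  cases c <;> rfl

theorem rank_eq_zero_iff {u : Vertex k} : u.rank = 0 ↔ u = y := by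
  cases u <;> simp [rank] <;> omega

theorem rank_add_one {u u' : Vertex k} (h : Edge u u') (hu : u ≠ y) : u'.rank + 1 = u.rank := by
  cases h <;> simp [rank] at hu ⊢ <;> omega

theorem edge_unique_of_rank_le {u v v' : Vertex k} (hu : u.rank ≤ 2 * k + 1)
    (hw : ∀ i, u ≠ w i) (h : Edge u v) (h' : Edge u v') : v = v' := by
  induction u using typeCases with
  | a i => simp only [rank] at hu; omega
  | request c i => rw [rank_request] at hu; omega
  | w i => exact absurd rfl (hw i)
  | response c i => rw [edge_response_iff.1 h, edge_response_iff.1 h']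
  | x => rw [edge_x_iff.1 h, edge_x_iff.1 h']
  | y => rw [edge_y_iff.1 h, edge_y_iff.1 h']

section Play

variable [NeZero k] (b : Fin k → Bool)

/-- The successor of a vertex when the choice at `a i` and at `w i` is described by `b i`. -/
def next : Vertex k → Vertex k
  | a i => request (b i) i
  | p i | p' i => aAt (i + 1)
  | w i => response (b i) i
  | r i | r' i => wAt (i + 1)
  | x | y => y

theorem next_request (c : Bool) (i : Fin k) : (request c i).next b = aAt (i + 1) := by
  cases c <;> rfl

theorem next_response (c : Bool) (i : Fin k) : (response c i).next b = wAt (i + 1) := by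
  cases c <;> rfl

theorem edge_next (u : Vertex k) : Edge u (u.next b) := by
  induction u using typeCases with
  | a i => exact edge_a_iff.2 ⟨_, rfl⟩
  | request c i => exact edge_request_iff.2 (next_request b c i)
  | w i => exact edge_w_iff.2 ⟨_, rfl⟩
  | response c i => exact edge_response_iff.2 (next_response b c i)
  | x => exact .last
  | y => exact .loop

/-- The play from `a 0` in which `b` describes the requests, and each of them is answered. -/
def play (n : ℕ) : Vertex k :=
  (next b)^[n] (a 0)

theorem play_succ (n : ℕ) : play b (n + 1) = (play b n).next b :=
  Function.iterate_succ_apply' _ _ _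

theorem isPath_play : (gammaGame k).IsPath (play b) := fun n => by
  rw [play_succ]
  exact edge_next b _

theorem rank_play (n : ℕ) : (play b n).rank = 4 * k + 1 - n := by
  induction n with
  | zero => rfl
  | succ n ih =>
    by_cases hy : play b n = y
    · rw [play_succ, hy]
      have := rank_eq_zero_iff.2 hy
      simp only [next, rank]
      omega
    · have := rank_add_one (isPath_play b n) hy
      omega

end Play

end Vertex

/-! ### The games `Γ_k` -/

namespace gammaGame

open Vertex

variable {k : ℕ}

/-- The index of the request-response pair with the request `request c i` and the response
`response c i`. -/
def pairIndex (c : Bool) (i : Fin k) : Fin (2 * k + 1) :=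
  match c with
  | true => ⟨2 * i + 1, by omega⟩
  | false => ⟨2 * i + 2, by omega⟩

theorem two_mul_lt_pairIndex (c : Bool) (i : Fin k) : 2 * (i : ℕ) < pairIndex c i := by
  cases c <;> simp [pairIndex]

theorem pairIndex_ne_zero (c : Bool) (i : Fin k) : pairIndex c i ≠ 0 :=
  Fin.val_ne_zero_iff.1 (Nat.ne_zero_of_lt (two_mul_lt_pairIndex c i))

theorem pairIndex_inj {c c' : Bool} {i i' : Fin k} :
    pairIndex c i = pairIndex c' i' ↔ c = c' ∧ i = i' := by
  cases c <;> cases c' <;> simp [pairIndex, Fin.ext_iff] <;> omega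

theorem mem_R_pairIndex_iff {c : Bool} {i : Fin k} {u : Vertex k} :
    u ∈ (gammaGame k).R (pairIndex c i) ↔ u = y ∨ u = response c i := by
  cases c <;> cases u <;> simp [gammaGame, pairIndex, response, eq_comm] <;> omega

section OpenRequests

variable (s : RRMemory (2 * k + 1))

theorem openRequests_a (i : Fin k) :
    (gammaGame k).openRequests s (a i) = s.1 ∪ {j | (i : ℕ) = 0 ∧ j = 0} := by
  ext j
  simp [RRGame.openRequests, gammaGame, Fin.ext_iff (a := j), -Fin.val_eq_zero_iff]

theorem openRequests_request (c : Bool) (i : Fin k) :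
    (gammaGame k).openRequests s (request c i) = s.1 ∪ {pairIndex c i} := by
  ext j
  cases c <;> simp [RRGame.openRequests, gammaGame, request, pairIndex, or_comm,
    Fin.ext_iff (a := j), -Fin.val_eq_zero_iff]

theorem openRequests_w (i : Fin k) :
    (gammaGame k).openRequests s (w i) = s.1 \ {j | (i : ℕ) = 0 ∧ j = 0} := by
  ext j
  simp [RRGame.openRequests, gammaGame, Fin.ext_iff (a := j), -Fin.val_eq_zero_iff]

theorem openRequests_response (c : Bool) (i : Fin k) :
    (gammaGame k).openRequests s (response c i) = s.1 \ {pairIndex c i} := by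
  ext j
  cases c <;> simp [RRGame.openRequests, gammaGame, response, pairIndex, Fin.ext_iff (a := j),
    -Fin.val_eq_zero_iff]

theorem openRequests_x : (gammaGame k).openRequests s x = s.1 := by
  ext j
  simp [RRGame.openRequests, gammaGame]

theorem openRequests_y : (gammaGame k).openRequests s y = ∅ := by
  ext j
  simp [RRGame.openRequests, gammaGame]

end OpenRequests

/-- A ranking function for the visits to `(∅, 1, 1, y)`: the vertex `y` has to be reached first, and
then all requests are closed and the marker advances with every move. -/
def potential (q : RRMemory (2 * k + 1) × Vertex k) : ℕ :=
  if q.2.rank = 0 then 2 * k + 1 - q.1.2.1 else 2 * k + 1 + q.2.rank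

theorem isRankingFunction_potential : IsRankingFunction (gammaGame k).buchi.E
    {(((∅, 0, true) : RRMemory (2 * k + 1)), y)} potential := by
  rintro ⟨s, u⟩ ⟨_, u'⟩ ⟨rfl, hE : Edge u u'⟩
  by_cases hu : u = y
  · obtain rfl := hu
    obtain rfl := edge_y_iff.1 hE
    have hmarker : (gammaGame k).marker s y = s.2.1 + 1 :=
      RRGame.marker_of_notMem (by rw [openRequests_y]; exact Set.notMem_empty _)
    rcases (Nat.add_one_le_iff.2 s.2.1.isLt).eq_or_lt with hlast | hlast
    · right
      have hs : s.2.1 = Fin.last (2 * k) := Fin.ext (Nat.succ_injective hlast)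
      simp [RRGame.update, hmarker, openRequests_y, hs]
    · left
      have hval := Fin.val_add_one_of_lt' hlast
      simp only [potential, rank, if_true, RRGame.update, hmarker, hval]
      omega
  · left
    have := rank_add_one hE hu
    simp only [potential]
    split_ifs <;> omega

theorem leftTotal_buchi_E [NeZero k] : Relator.LeftTotal (gammaGame k).buchi.E :=
  RRGame.leftTotal_buchi fun u => ⟨_, edge_next (fun _ => true) u⟩

theorem isRankingFunction_potential_F : IsRankingFunction (gammaGame k).buchi.E
    (gammaGame k).buchi.F potential :=
  isRankingFunction_potential.mono fun _ hq => hq ▸ rfl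

theorem mem_win_of_isPath_buchi {ρ : ℕ → RRMemory (2 * k + 1) × Vertex k}
    (hρ : (gammaGame k).buchi.IsPath ρ) : ρ ∈ (gammaGame k).buchi.toGame.win :=
  isRankingFunction_potential_F.frequently_mem hρ

theorem isWinningFrom_attractorStrategy
    {g : RRMemory (2 * k + 1) × Vertex k → RRMemory (2 * k + 1) × Vertex k}
    (hg : (gammaGame k).buchi.IsAttractorStrategy g) (q : RRMemory (2 * k + 1) × Vertex k) :
    (gammaGame k).buchi.toGame.IsWinningFrom (positional g) q :=
  Game.isWinningFrom_positional (fun _ => mem_win_of_isPath_buchi) hg.edge q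

theorem recur_buchi [NeZero k] : (gammaGame k).buchi.recur = (gammaGame k).buchi.F :=
  BuchiGame.recur_eq_of_forall_isPath leftTotal_buchi_E fun _ => mem_win_of_isPath_buchi

theorem exists_isAttractorStrategy [NeZero k] :
    ∃ g, (gammaGame k).buchi.IsAttractorStrategy g := by
  refine BuchiGame.exists_isAttractorStrategy leftTotal_buchi_E fun q => ⟨potential q + 1, ?_⟩
  rw [recur_buchi]
  exact isRankingFunction_potential_F.mem_attr leftTotal_buchi_E q

section Memory

variable (b : Fin k → Bool)

/-- The memory content when the play in which `b` describes the requests arrives at `aAt i`. -/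
def requestMemory (i : ℕ) : RRMemory (2 * k + 1) :=
  ({j | (j = 0 ∧ 0 < i) ∨ ∃ l : Fin k, l < i ∧ j = pairIndex (b l) l}, 0, false)

/-- The memory content when the play in which `b` describes the requests, and each of them is
answered, arrives at `wAt i`. -/
def responseMemory (i : ℕ) : RRMemory (2 * k + 1) :=
  ({j | (j = 0 ∧ i = 0) ∨ ∃ l : Fin k, i ≤ l ∧ j = pairIndex (b l) l}, Fin.ofNat _ (2 * i), false)

/-- The memory content after leaving `wAt i` in the situation of `responseMemory`. -/
def pendingMemory (i : ℕ) : RRMemory (2 * k + 1) :=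
  ({j | ∃ l : Fin k, i ≤ l ∧ j = pairIndex (b l) l}, Fin.ofNat _ (2 * i + 1), false)

theorem requestMemory_zero : requestMemory b 0 = RRMemory.start (2 * k + 1) := by
  simp [requestMemory, RRMemory.start]

theorem requestMemory_self [NeZero k] : requestMemory b k = responseMemory b 0 := by
  simp [requestMemory, responseMemory, NeZero.pos k]

theorem update_update_requestMemory (i : Fin k) :
    (gammaGame k).update ((gammaGame k).update (requestMemory b i) (a i)) (request (b i) i) =
      requestMemory b (i + 1) := by
  have hk : ((0 : Fin (2 * k + 1)) : ℕ) + 1 < 2 * k + 1 := by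
    have := i.isLt
    simp only [Fin.val_zero]
    omega
  have hmid : (gammaGame k).update (requestMemory b i) (a i) =
      ({j | j = 0 ∨ ∃ l : Fin k, l < i ∧ j = pairIndex (b l) l}, 0, false) := by
    have hopen : (gammaGame k).openRequests (requestMemory b i) (a i) =
        {j | j = 0 ∨ ∃ l : Fin k, l < i ∧ j = pairIndex (b l) l} := by
      rw [openRequests_a]
      ext j
      simp only [requestMemory, Set.mem_union, Set.mem_ofPred_eq, Fin.lt_def]
      grind
    rw [RRGame.update_eq_of_mem (by rw [hopen]; exact Or.inl rfl) hk, hopen]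
    rfl
  rw [hmid, RRGame.update_eq_of_mem (by rw [openRequests_request]; exact Or.inl (Or.inl rfl)) hk,
    openRequests_request]
  refine Prod.ext (Set.ext fun j => ?_) rfl
  simp only [requestMemory, Set.mem_union, Set.mem_ofPred_eq, Set.mem_singleton_iff]
  grind

theorem update_responseMemory (i : Fin k) :
    (gammaGame k).update (responseMemory b i) (w i) = pendingMemory b i := by
  have hval : ((responseMemory b i).2.1 : ℕ) = 2 * i := Nat.mod_eq_of_lt (by omega)
  have hopen : (gammaGame k).openRequests (responseMemory b i) (w i) = (pendingMemory b i).1 := by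
    rw [openRequests_w]
    ext j
    have := fun l => pairIndex_ne_zero (b l) l
    simp only [responseMemory, pendingMemory, Set.mem_sdiff, Set.mem_ofPred_eq]
    grind
  have hnot : (responseMemory b i).2.1 ∉ (gammaGame k).openRequests (responseMemory b i) (w i) := by
    rw [hopen]
    rintro ⟨l, hl, heq⟩
    have := two_mul_lt_pairIndex (b l) l
    omega
  rw [RRGame.update_eq_of_notMem hnot (by omega), hopen]
  refine Prod.ext rfl (Prod.ext (Fin.ext ?_) rfl)
  rw [Fin.val_add_one_of_lt' (by omega), hval]
  exact (Nat.mod_eq_of_lt (by omega)).symm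

theorem update_pendingMemory (i : Fin k) :
    (gammaGame k).update (pendingMemory b i) (response (b i) i) = responseMemory b (i + 1) := by
  have hval : ((pendingMemory b i).2.1 : ℕ) = 2 * i + 1 := Nat.mod_eq_of_lt (by omega)
  have hopen : (gammaGame k).openRequests (pendingMemory b i) (response (b i) i) =
      (responseMemory b (i + 1)).1 := by
    rw [openRequests_response]
    ext j
    simp only [responseMemory, pendingMemory, Set.mem_sdiff, Set.mem_ofPred_eq,
      Set.mem_singleton_iff]
    grind [pairIndex_inj]
  have hnot : (pendingMemory b i).2.1 ∉
      (gammaGame k).openRequests (pendingMemory b i) (response (b i) i) := by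
    rw [hopen]
    rintro (⟨-, h⟩ | ⟨l, hl, heq⟩)
    · omega
    · have := two_mul_lt_pairIndex (b l) l
      omega
  rw [RRGame.update_eq_of_notMem hnot (by omega), hopen]
  refine Prod.ext rfl (Prod.ext (Fin.ext ?_) rfl)
  rw [Fin.val_add_one_of_lt' (by omega), hval]
  exact (Nat.mod_eq_of_lt (by omega)).symm

theorem lift_play_two_mul [NeZero k] {i : ℕ} (hi : i ≤ k) :
    (gammaGame k).lift (play b) (2 * i) = (requestMemory b i, aAt i) := by
  induction i with
  | zero => rw [requestMemory_zero, aAt_of_lt (NeZero.pos k)]; rfl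
  | succ i ih =>
    have hik : i < k := hi
    have hlift := ih hik.le
    have ha : play b (2 * i) = a ⟨i, hik⟩ := (congrArg Prod.snd hlift).trans (aAt_of_lt hik)
    have hrequest : play b (2 * i + 1) = request (b ⟨i, hik⟩) ⟨i, hik⟩ := by
      rw [play_succ, ha, next]
    have haAt : play b (2 * i + 1 + 1) = aAt (i + 1) := by rw [play_succ, hrequest, next_request]
    rw [mul_add_one, RRGame.lift_succ, RRGame.lift_succ, hlift, ha, hrequest, haAt]
    exact congrArg (·, _) (update_update_requestMemory b ⟨i, hik⟩)

theorem lift_play_two_mul_add [NeZero k] {i : ℕ} (hi : i ≤ k) :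
    (gammaGame k).lift (play b) (2 * k + 2 * i) = (responseMemory b i, wAt i) := by
  induction i with
  | zero => rw [← requestMemory_self, ← aAt_self]; exact lift_play_two_mul b le_rfl
  | succ i ih =>
    have hik : i < k := hi
    have hlift := ih hik.le
    have hw : play b (2 * k + 2 * i) = w ⟨i, hik⟩ := (congrArg Prod.snd hlift).trans (wAt_of_lt hik)
    have hresponse : play b (2 * k + 2 * i + 1) = response (b ⟨i, hik⟩) ⟨i, hik⟩ := by
      rw [play_succ, hw, next]
    have hwAt : play b (2 * k + 2 * i + 1 + 1) = wAt (i + 1) := by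
      rw [play_succ, hresponse, next_response]
    rw [mul_add_one, ← add_assoc, RRGame.lift_succ, RRGame.lift_succ, hlift, hw, hresponse, hwAt,
      update_responseMemory b ⟨i, hik⟩, update_pendingMemory b ⟨i, hik⟩]

theorem play_eq_w [NeZero k] (i : Fin k) : play b (2 * k + 2 * i) = w i :=
  (congrArg Prod.snd (lift_play_two_mul_add b i.isLt.le)).trans (wAt_of_lt i.isLt)

theorem response_notMem_V₀ (c : Bool) (i : Fin k) : response c i ∉ (gammaGame k).V₀ := by
  cases c <;> exact nofun

theorem responseMemory_mem_attr [NeZero k] {i : ℕ} (hi : i ≤ k) :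
    (responseMemory b i, wAt i) ∈
      (gammaGame k).buchi.attr (gammaGame k).buchi.F (2 * (k - i) + 1) := by
  induction hi using Nat.decreasingInduction with
  | self =>
    rw [Nat.sub_self, wAt_self]
    refine Or.inr ⟨(nomatch ·), ?_⟩
    rintro ⟨_, u⟩ ⟨rfl, -⟩
    have hval : ((responseMemory b k).2.1 : ℕ) = 2 * k := Nat.mod_eq_of_lt (by omega)
    have hnot : (responseMemory b k).2.1 ∉ (gammaGame k).openRequests (responseMemory b k) x := by
      rw [openRequests_x]
      rintro (⟨-, h⟩ | ⟨l, hl, -⟩)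
      exacts [NeZero.ne k h, l.isLt.not_ge hl]
    refine RRGame.update_flag_eq_true_iff.2 ⟨congrArg (· + 1) hval, ?_⟩
    rw [RRGame.marker_of_notMem hnot, show (responseMemory b k).2.1 = Fin.last _ from Fin.ext hval,
      Fin.last_add_one]
  | of_succ i hi ih =>
    have hresponse : (pendingMemory b i, response (b ⟨i, hi⟩) ⟨i, hi⟩) ∈
        (gammaGame k).buchi.attr (gammaGame k).buchi.F (2 * (k - (i + 1)) + 2) := by
      refine Or.inr ⟨response_notMem_V₀ _ _, ?_⟩
      rintro ⟨_, u⟩ ⟨rfl, hE : Edge (response (b ⟨i, hi⟩) ⟨i, hi⟩) u⟩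
      obtain rfl := edge_response_iff.1 hE
      exact update_pendingMemory b ⟨i, hi⟩ ▸ ih
    rw [wAt_of_lt hi, show 2 * (k - i) + 1 = 2 * (k - (i + 1)) + 2 + 1 by omega]
    exact Or.inl (Or.inr ⟨⟨_, rfl⟩, _,
      ⟨(update_responseMemory b ⟨i, hi⟩).symm, edge_w_iff.2 ⟨_, rfl⟩⟩, hresponse⟩)

variable {b}

theorem mem_avoiding_R_pairIndex {c : Bool} {i : Fin k} {u : Vertex k} {n : ℕ} (hn : n ≤ u.rank)
    (hu : u.rank ≤ 2 * k - 2 * i) (hne : u ≠ response c i) :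
    u ∈ (gammaGame k).avoiding ((gammaGame k).R (pairIndex c i)) n := by
  induction n generalizing u with
  | zero => exact Set.mem_univ _
  | succ n ih =>
    have hy : u ≠ y := fun h => absurd (rank_eq_zero_iff.2 h) (by omega)
    refine ⟨fun h => (mem_R_pairIndex_iff.1 h).elim hy hne, fun u' hE => ?_⟩
    have hrank := rank_add_one hE hy
    refine ih (by omega) (by omega) fun h => ?_
    rw [h, rank_response] at hrank
    omega

theorem pendingMemory_notMem_attr [NeZero k] {c : Bool} {i : Fin k} (hc : c ≠ b i) :
    (pendingMemory b i, response c i) ∉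
      (gammaGame k).buchi.attr (gammaGame k).buchi.F (2 * (k - i)) := by
  have hval : ((pendingMemory b i).2.1 : ℕ) = 2 * i + 1 := Nat.mod_eq_of_lt (by omega)
  have hresponse : response c i ∈
      (gammaGame k).avoiding ((gammaGame k).R (pairIndex (b i) i)) (2 * (k - i)) := by
    refine mem_avoiding_R_pairIndex ?_ (rank_response c i).le fun h =>
      hc (response_left_injective i h)
    rw [rank_response]
    omega
  exact Arena.notMem_attr_of_mem_avoiding leftTotal_buchi_E <|
    RRGame.mem_avoiding_of_open (by omega) ⟨i, le_rfl, rfl⟩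
      (Fin.le_def.2 (hval ▸ two_mul_lt_pairIndex (b i) i)) rfl hresponse

end Memory

section AttractorStrategy

variable [NeZero k] {g : RRMemory (2 * k + 1) × Vertex k → RRMemory (2 * k + 1) × Vertex k}
  (hg : (gammaGame k).buchi.IsAttractorStrategy g) (b : Fin k → Bool)

include hg

theorem attractorStrategy_apply (i : Fin k) :
    (g (responseMemory b i, w i)).2 = response (b i) i := by
  have hval : ((responseMemory b i).2.1 : ℕ) = 2 * i := Nat.mod_eq_of_lt (by omega)
  have hattr := responseMemory_mem_attr b i.isLt.le
  rw [wAt_of_lt i.isLt] at hattr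
  have hnot := Arena.notMem_attr_of_mem_avoiding leftTotal_buchi_E <|
    RRGame.mem_avoiding_of_marker_add_lt (Γ := gammaGame k) (s := responseMemory b i) (u := w i)
      (n := 2 * (k - i)) rfl (by omega)
  have hdecrease := hg.decrease (responseMemory b i, w i) ⟨i, rfl⟩ (2 * (k - i))
  rw [recur_buchi] at hdecrease
  obtain ⟨hmem, hedge⟩ := hg.edge (responseMemory b i, w i) ⟨i, rfl⟩
  obtain ⟨c, hc⟩ := edge_w_iff.1 hedge
  rw [hc]
  by_contra hne
  refine pendingMemory_notMem_attr (b := b) (c := c) (i := i) (fun h => hne (h ▸ rfl)) ?_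
  rw [← update_responseMemory, ← hc]
  exact hmem ▸ hdecrease hattr hnot

theorem conforms_play : (gammaGame k).Conforms ((gammaGame k).strategyAutomaton g).toStrategy
    (play b) := by
  rintro n ⟨i, hi⟩
  have hrank := rank_play b n
  rw [hi, rank] at hrank
  obtain rfl : n = 2 * k + 2 * i := by omega
  have hlift := lift_play_two_mul_add b i.isLt.le
  rw [wAt_of_lt i.isLt] at hlift
  change _ = (g ((gammaGame k).lift (play b) _)).2
  rw [hlift, attractorStrategy_apply hg, play_succ, hi, next]

theorem injective_state_of_implements {M : Type*} {C : Mealy (Vertex k) M}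
    (hC : C.Implements (gammaGame k).toArena ((gammaGame k).strategyAutomaton g).toStrategy (a 0)) :
    Function.Injective fun b : Fin k → Bool => (past (play b) (2 * k)).foldl C.step C.init := by
  intro b b' hstate
  have hdet : ∀ m, 2 * k ≤ m → play b m ∉ (gammaGame k).V₀ →
      ∀ u u', Edge (play b m) u → Edge (play b m) u' → u = u' := fun m hm hnot u u' =>
    edge_unique_of_rank_le (by rw [rank_play]; omega) fun i h => hnot ⟨i, h⟩
  have heq := hC.eq_of_state_eq (isPath_play b) (isPath_play b') rfl rfl (conforms_play hg b)
    (conforms_play hg b') hstate ((play_eq_w b 0).trans (play_eq_w b' 0).symm) hdet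
  funext i
  have hresponse := heq (2 * k + 2 * i + 1) (by omega)
  rw [play_succ, play_succ, play_eq_w, play_eq_w] at hresponse
  exact response_left_injective i hresponse

theorem two_pow_le_card_of_implements {M : Type*} [Finite M] {C : Mealy (Vertex k) M}
    (hC : C.Implements (gammaGame k).toArena ((gammaGame k).strategyAutomaton g).toStrategy (a 0)) :
    2 ^ k ≤ Nat.card M := by
  simpa using Nat.card_le_card_of_injective _ (injective_state_of_implements hg hC)

end AttractorStrategy

end gammaGame

theorem mainTheorem1 (k : ℕ) [NeZero k] :
    -- the Büchi game simulates the request-response game, and Player 0 wins the latter from `v`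
    Simulates (gammaGame k).toGame (RRMemory.start (2 * k + 1)) (gammaGame k).buchi.toGame ∧
    (gammaGame k).toGame.Wins (.a 0) ∧
    -- positional attractor strategies exist; each of them is winning from `(∅, 1, 0, v)` and yields
    -- a winning strategy from `v`, whose implementation needs at least `2 ^ k` memory contents
    (∃ g, (gammaGame k).buchi.IsAttractorStrategy g) ∧
    (∀ g, (gammaGame k).buchi.IsAttractorStrategy g →
      (gammaGame k).buchi.toGame.IsWinningFrom (positional g) (RRMemory.start (2 * k + 1), .a 0) ∧
      (gammaGame k).toGame.IsWinningFrom ((gammaGame k).strategyAutomaton g).toStrategy (.a 0) ∧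
      ∀ (M : Type) [Finite M] (C : Mealy (Vertex k) M),
        C.Implements (gammaGame k).toArena ((gammaGame k).strategyAutomaton g).toStrategy (.a 0) →
        2 ^ k ≤ Nat.card M) ∧
    -- every path in the Büchi game visits `(∅, 1, 1, y)` infinitely often
    (∀ ρ, (gammaGame k).buchi.IsPath ρ →
      ∃ᶠ n in atTop, ρ n = (((∅, 0, true) : RRMemory (2 * k + 1)), Vertex.y)) ∧
    -- all states are final in the closure
    (gammaGame k).automaton.closure.F = Set.univ ∧
    -- the reduced game graph has exactly one memory content
    (∀ prec : RRMemory (2 * k + 1) → RRMemory (2 * k + 1) → Prop,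
      IsStrictTotalOrder (RRMemory (2 * k + 1)) prec →
      Nat.card ((gammaGame k).memoryReduction prec).Mem = 1 ∧
      Nat.card ((gammaGame k).delayedReduction prec).Mem = 1) := by
  have hK : 1 < 2 * k + 1 := by have := NeZero.pos k; omega
  have hwin (g) (hg : (gammaGame k).buchi.IsAttractorStrategy g) :
      (gammaGame k).toGame.IsWinningFrom ((gammaGame k).strategyAutomaton g).toStrategy (.a 0) :=
    RRGame.isWinningFrom_strategyAutomaton hK (gammaGame.isWinningFrom_attractorStrategy hg _)
  obtain ⟨g₀, hg₀⟩ := gammaGame.exists_isAttractorStrategy (k := k)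
  refine ⟨RRGame.simulates_buchi hK _, ⟨_, hwin g₀ hg₀⟩, ⟨g₀, hg₀⟩, fun g hg => ⟨?_, hwin g hg, ?_⟩,
    ?_, ?_, fun prec _ => ⟨?_, ?_⟩⟩
  · exact gammaGame.isWinningFrom_attractorStrategy hg _
  · exact fun M _ C hC => gammaGame.two_pow_le_card_of_implements hg hC
  · exact fun ρ hρ => gammaGame.isRankingFunction_potential.frequently_mem hρ
  · exact RRGame.closure_F_eq_univ gammaGame.isRankingFunction_potential_F
  · exact RRGame.card_memoryReduction_mem gammaGame.isRankingFunction_potential_F prec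
  · exact RRGame.card_delayedReduction_mem gammaGame.isRankingFunction_potential_F prec
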